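/- Let $H_n=\mathbb C^n\times\mathbb R$ be the Heisenberg group with contact form $\Theta=dt+\sum_\beta (x_\beta\,dy_\beta-y_\beta\,dx_\beta)$, Reeb field $T=\partial_t$, its standard CR structure $J$ on $\ker\Theta$, and the adapted metric for which the fields $\partial_{x_\beta}+y_\beta\partial_t$, $\partial_{y_\beta}-x_\beta\partial_t$, $T$ are orthonormal. Let $m\ge 1$ and $n=m+1$, and let $(M,\hat J,\hat\theta)$ be a simply connected $(2m+1)$-dimensional pseudohermitian submanifold of $H_n$, i.e. a pseudohermitian manifold with an immersion $f:M\to H_n$ such that $\hat\theta=f^*\Theta$ and $df\circ\hat J=J\circ df$ on $\ker\hat\theta$. Let $\nu$ be its fundamental vector field: the unique horizontal field along $M$ orthogonal to $df(\ker\hat\theta)$ for which $T+\nu$ is tangent to $M$. Let its second fundamental form $II$ be the part normal to $M$ of $\nabla_YX$, for $X,Y$ in the $(1,0)$-part of $\ker\hat\theta\otimes\mathbb C$, where $\nabla$ is the pseudohermitian connection of $H_n$. Suppose that $\nu$ is nowhere zero. Then the pseudohermitian (Tanaka–Webster) torsion of $(M,\hat J,\hat\theta)$ vanishes identically if and only if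 $II$ vanishes identically. If this is the case, then $|\nu|$ (the length for the adapted metric) is a positive constant, the Webster scalar curvature of $(M,\hat J,\hat\theta)$ (with respect to unitary admissible coframes, $d\hat\theta=i\sum_k\theta^k\wedge\theta^{\bar k}$) is the constant $m(m+1)|\nu|^2$, and after a Heisenberg rigid motion (a left translation composed with a unitary rotation about the $t$-axis) $M$ is an open part of the standard sphere $$S^{2m+1}(r)=\{(z,0)\in\mathbb C^n\times\{0\} : |z|=r\},\qquad r=\frac1{|\nu|};$$ that is, there is a rigid motion $\Phi$ such that $\Phi\circ f$ is a local homeomorphism into $S^{2m+1}(r)$, and an open embedding into it if $f$ is injective. -/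

import Mathlib

open Set Filter Topology
open scoped Manifold ContDiff ComplexConjugate

noncomputable section

/-! ### The Heisenberg group -/

/-- The Heisenberg group `H_n = ℂⁿ × ℝ`, with points `(z, t)`, `z = x + i y`. It is a real vector
space, and every tangent space is identified with it. -/
abbrev Heis (n : ℕ) : Type := EuclideanSpace ℂ (Fin n) × ℝ

namespace Heis

variable {n : ℕ}

/-- The group law `(x,y,t) ∘ (x',y',t') = (x + x', y + y', t + t' + y x' - x y')`. -/
def mul (p q : Heis n) : Heis n := (p.1 + q.1, p.2 + q.2 - (inner ℂ p.1 q.1).im)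

/-- The standard contact form `Θ = dt + ∑ (x dy - y dx)` at `q`, evaluated on `v`. -/
def Θ (q v : Heis n) : ℝ := v.2 + (inner ℂ q.1 v.1).im

/-- The Reeb vector field `T = ∂/∂t`. -/
def T : Heis n := (0, 1)

/-- The horizontal vector at `q` with `ℂⁿ`-component `w = a + i b`, that is `∑ a_β e_β + b_β e_{n+β}`
with `e_β = ∂/∂x_β + y_β ∂/∂t` and `e_{n+β} = ∂/∂y_β - x_β ∂/∂t`. -/
def hlift (q : Heis n) (w : EuclideanSpace ℂ (Fin n)) : Heis n := (w, -(inner ℂ q.1 w).im)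

/-- The standard CR structure: `J e_β = e_{n+β}`, `J e_{n+β} = - e_β` (and `J T = 0`). -/
def J (q v : Heis n) : Heis n := hlift q (Complex.I • v.1)

/-- The adapted metric at `q`, for which `e_β, e_{n+β}, T` are orthonormal. -/
def metric (q v w : Heis n) : ℝ := (inner ℂ v.1 w.1).re + Θ q v * Θ q w

/-- The length of a tangent vector at `q` for the adapted metric. -/
def length (q v : Heis n) : ℝ := Real.sqrt (metric q v v)

/-- Heisenberg rigid motions: compositions of a left translation with a unitary rotation around the
`t`-axis. -/
def IsRigidMotion (Φ : Heis n → Heis n) : Prop :=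
  ∃ (p : Heis n) (U : EuclideanSpace ℂ (Fin n) ≃ₗᵢ[ℂ] EuclideanSpace ℂ (Fin n)),
    ∀ q, Φ q = mul p (U q.1, q.2)

/-- The standard sphere of radius `r` in `ℂⁿ × {0}`. -/
def sphere (n : ℕ) (r : ℝ) : Set (Heis n) := {q | ‖q.1‖ = r ∧ q.2 = 0}

end Heis

/-! ### One-forms on a real vector space -/

section Forms

variable {E F : Type*} [NormedAddCommGroup E] [NormedSpace ℝ E] [NormedAddCommGroup F]
  [NormedSpace ℝ F]

/-- The exterior derivative `dα (v, w)` of a one-form. -/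
def dForm (α : E → E →L[ℝ] F) (x v w : E) : F := fderiv ℝ α x v w - fderiv ℝ α x w v

/-- The wedge product of two complex covectors, evaluated on `(v, w)`. -/
def wedge (a b : E →L[ℝ] ℂ) (v w : E) : ℂ := a v * b w - a w * b v

/-- The complex conjugate of a complex covector. -/
def conjForm (a : E →L[ℝ] ℂ) : E →L[ℝ] ℂ := (Complex.conjCLE : ℂ →L[ℝ] ℂ).comp a

/-- A real covector as a complex one. -/
def toComplexForm (a : E →L[ℝ] ℝ) : E →L[ℝ] ℂ := Complex.ofRealCLM.comp a

end Forms

/-! ### Pseudohermitian manifolds -/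

/-- The model space of manifolds of CR dimension `m`. -/
abbrev PHModel (m : ℕ) : Type := EuclideanSpace ℝ (Fin (2 * m + 1))

section Charts

variable {m : ℕ} {M : Type*} [TopologicalSpace M] [ChartedSpace (PHModel m) M]

/-- A one-form on `M`, read in the chart `e`. -/
def formInChart (e : OpenPartialHomeomorph M (PHModel m))
    (α : ∀ p : M, TangentSpace 𝓘(ℝ, PHModel m) p →L[ℝ] ℝ) :
    PHModel m → PHModel m →L[ℝ] ℝ := fun x =>
  (α (e.symm x)).comp (mfderiv 𝓘(ℝ, PHModel m) 𝓘(ℝ, PHModel m) e.symm x)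

/-- A field of endomorphisms of the tangent spaces of `M`, read in the chart `e`. -/
def endoInChart (e : OpenPartialHomeomorph M (PHModel m))
    (J : ∀ p : M, TangentSpace 𝓘(ℝ, PHModel m) p →L[ℝ] TangentSpace 𝓘(ℝ, PHModel m) p) :
    PHModel m → PHModel m →L[ℝ] PHModel m := fun x =>
  (mfderiv 𝓘(ℝ, PHModel m) 𝓘(ℝ, PHModel m) e (e.symm x)).comp
    ((J (e.symm x)).comp (mfderiv 𝓘(ℝ, PHModel m) 𝓘(ℝ, PHModel m) e.symm x))

end Charts

/-- A (strictly pseudoconvex) pseudohermitian structure on a `(2m+1)`-dimensional manifold: a contact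
form `θ` and an integrable CR structure `J` on `ker θ` with positive Levi form `dθ (·, J ·)`. As
usual `J` is extended to the whole tangent space by zero on the Reeb direction. -/
structure PseudohermitianStructure (m : ℕ) (M : Type*) [TopologicalSpace M]
    [ChartedSpace (PHModel m) M] [IsManifold 𝓘(ℝ, PHModel m) ∞ M] where
  θ : ∀ p : M, TangentSpace 𝓘(ℝ, PHModel m) p →L[ℝ] ℝ
  J : ∀ p : M, TangentSpace 𝓘(ℝ, PHModel m) p →L[ℝ] TangentSpace 𝓘(ℝ, PHModel m) p
  smooth_θ : ∀ e ∈ IsManifold.maximalAtlas 𝓘(ℝ, PHModel m) ∞ M,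
    ContDiffOn ℝ ∞ (formInChart e θ) e.target
  smooth_J : ∀ e ∈ IsManifold.maximalAtlas 𝓘(ℝ, PHModel m) ∞ M,
    ContDiffOn ℝ ∞ (endoInChart e J) e.target
  θ_ne_zero : ∀ p, θ p ≠ 0
  θ_J : ∀ p v, θ p (J p v) = 0
  J_J : ∀ p v, θ p v = 0 → J p (J p v) = -v
  J_reeb : ∀ e ∈ IsManifold.maximalAtlas 𝓘(ℝ, PHModel m) ∞ M, ∀ x ∈ e.target, ∀ v,
    (∀ w, dForm (formInChart e θ) x v w = 0) → endoInChart e J x v = 0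
  levi_pos : ∀ e ∈ IsManifold.maximalAtlas 𝓘(ℝ, PHModel m) ∞ M, ∀ x ∈ e.target, ∀ v,
    formInChart e θ x v = 0 → v ≠ 0 → 0 < dForm (formInChart e θ) x v (endoInChart e J x v)
  /-- The bundle spanned by the vector fields `X - i J X`, `X ∈ ker θ`, is involutive. -/
  integrable : ∀ e ∈ IsManifold.maximalAtlas 𝓘(ℝ, PHModel m) ∞ M,
    ∀ V : Set (PHModel m), IsOpen V → V ⊆ e.target → ∀ X Y : PHModel m → PHModel m,
    ContDiffOn ℝ ∞ X V → ContDiffOn ℝ ∞ Y V →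
    (∀ x ∈ V, formInChart e θ x (X x) = 0) → (∀ x ∈ V, formInChart e θ x (Y x) = 0) →
    ∀ x ∈ V,
      let JX : PHModel m → PHModel m := fun y => endoInChart e J y (X y)
      let JY : PHModel m → PHModel m := fun y => endoInChart e J y (Y y)
      let B := VectorField.lieBracket ℝ X Y x - VectorField.lieBracket ℝ JX JY x
      formInChart e θ x B = 0 ∧
        endoInChart e J x B = VectorField.lieBracket ℝ JX Y x + VectorField.lieBracket ℝ X JY x

/-! ### Connection, torsion and curvature, in coordinates -/

section Coframes

variable {m : ℕ}

/-- `ϑ¹, …, ϑᵐ` is a unitary admissible coframe on `V` for the structure `(θ, J)`: the `ϑʲ` are of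
type `(1,0)`, together with `θ` they form a coframe, and `dθ = i ∑ ϑᵏ ∧ ϑ^{k̄}` (in particular the
`ϑʲ` vanish on the Reeb field). -/
structure IsAdmissibleCoframe (V : Set (PHModel m)) (θ : PHModel m → PHModel m →L[ℝ] ℝ)
    (J : PHModel m → PHModel m →L[ℝ] PHModel m)
    (ϑ : Fin m → PHModel m → PHModel m →L[ℝ] ℂ) : Prop where
  smooth : ∀ j, ContDiffOn ℝ ∞ (ϑ j) V
  type_one_zero : ∀ x ∈ V, ∀ j v, θ x v = 0 → ϑ j x (J x v) = Complex.I * ϑ j x v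
  coframe : ∀ x ∈ V, ∀ v, θ x v = 0 → (∀ j, ϑ j x v = 0) → v = 0
  levi : ∀ x ∈ V, ∀ v w,
    ((dForm θ x v w : ℝ) : ℂ) = Complex.I * ∑ k, wedge (ϑ k x) (conjForm (ϑ k x)) v w

/-- The torsion forms `τʲ = ∑ Aʲ_{k̄} ϑ^{k̄}`. -/
def torsionForm (ϑ : Fin m → PHModel m → PHModel m →L[ℝ] ℂ) (A : Fin m → Fin m → PHModel m → ℂ)
    (j : Fin m) (x : PHModel m) : PHModel m →L[ℝ] ℂ :=
  ∑ k, A j k x • conjForm (ϑ k x)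

/-- `φ k j = θ_k{}^j` are the pseudohermitian (Tanaka-Webster) connection forms and `A j k = Aʲ_{k̄}`
the coefficients of the pseudohermitian torsion for the coframe `ϑ`:
`θ_k{}^j + θ_{j̄}{}^{k̄} = 0` and `dϑʲ = ∑ ϑᵏ ∧ θ_k{}^j + θ ∧ τʲ`. -/
structure IsConnection (V : Set (PHModel m)) (θ : PHModel m → PHModel m →L[ℝ] ℝ)
    (ϑ : Fin m → PHModel m → PHModel m →L[ℝ] ℂ)
    (φ : Fin m → Fin m → PHModel m → PHModel m →L[ℝ] ℂ)
    (A : Fin m → Fin m → PHModel m → ℂ) : Prop where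
  smooth_φ : ∀ k j, ContDiffOn ℝ ∞ (φ k j) V
  smooth_A : ∀ j k, ContDiffOn ℝ ∞ (A j k) V
  skew : ∀ x ∈ V, ∀ k j, φ k j x + conjForm (φ j k x) = 0
  structure_eq : ∀ x ∈ V, ∀ j v w,
    dForm (ϑ j) x v w = ∑ k, wedge (ϑ k x) (φ k j x) v w
      + wedge (toComplexForm (θ x)) (torsionForm ϑ A j x) v w

/-- `R k j p q = R_k{}^j{}_{p q̄}` are the coefficients of the Webster curvature tensor: modulo `θ`,
`dθ_k{}^j - ∑ θ_k{}^l ∧ θ_l{}^j = ∑ R_k{}^j{}_{p q̄} ϑᵖ ∧ ϑ^{q̄} + i ϑ^{k̄} ∧ τʲ - i τ^{k̄} ∧ ϑʲ`. -/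
def IsCurvature (V : Set (PHModel m)) (θ : PHModel m → PHModel m →L[ℝ] ℝ)
    (ϑ : Fin m → PHModel m → PHModel m →L[ℝ] ℂ)
    (φ : Fin m → Fin m → PHModel m → PHModel m →L[ℝ] ℂ)
    (A : Fin m → Fin m → PHModel m → ℂ)
    (R : Fin m → Fin m → Fin m → Fin m → PHModel m → ℂ) : Prop :=
  ∀ x ∈ V, ∀ k j v w, θ x v = 0 → θ x w = 0 →
    dForm (φ k j) x v w - ∑ l, wedge (φ k l x) (φ l j x) v w =
      ∑ p, ∑ q, R k j p q x * wedge (ϑ p x) (conjForm (ϑ q x)) v w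
        + Complex.I * wedge (conjForm (ϑ k x)) (torsionForm ϑ A j x) v w
        - Complex.I * wedge (conjForm (torsionForm ϑ A k x)) (ϑ j x) v w

end Coframes

section Invariants

variable {m : ℕ} {M : Type*} [TopologicalSpace M] [ChartedSpace (PHModel m) M]
  [IsManifold 𝓘(ℝ, PHModel m) ∞ M]

/-- The pseudohermitian torsion vanishes identically: its coefficients with respect to every local
unitary admissible coframe are zero. -/
def TorsionVanishes (S : PseudohermitianStructure m M) : Prop :=
  ∀ e ∈ IsManifold.maximalAtlas 𝓘(ℝ, PHModel m) ∞ M,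
    ∀ V : Set (PHModel m), IsOpen V → V ⊆ e.target → ∀ ϑ φ A,
      IsAdmissibleCoframe V (formInChart e S.θ) (endoInChart e S.J) ϑ →
      IsConnection V (formInChart e S.θ) ϑ φ A →
      ∀ x ∈ V, ∀ j k, A j k x = 0

/-- `r` is the value at `p` of the Webster (scalar) curvature `R = ∑ R_k{}^k{}_{l l̄}`. -/
def IsWebsterCurvatureAt (S : PseudohermitianStructure m M) (p : M) (r : ℝ) : Prop :=
  ∃ e ∈ IsManifold.maximalAtlas 𝓘(ℝ, PHModel m) ∞ M, p ∈ e.source ∧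
    ∃ V : Set (PHModel m), IsOpen V ∧ V ⊆ e.target ∧ e p ∈ V ∧ ∃ ϑ φ A R,
      IsAdmissibleCoframe V (formInChart e S.θ) (endoInChart e S.J) ϑ ∧
      IsConnection V (formInChart e S.θ) ϑ φ A ∧
      IsCurvature V (formInChart e S.θ) ϑ φ A R ∧
      (r : ℂ) = ∑ k, ∑ l, R k k l l (e p)

/-! ### Pseudohermitian submanifolds of the Heisenberg group -/

variable {n : ℕ}

/-- The differential of `f : M → H_n` at `p`. -/
def diffAt (f : M → Heis n) (p : M) : TangentSpace 𝓘(ℝ, PHModel m) p →L[ℝ] Heis n :=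
  mfderiv 𝓘(ℝ, PHModel m) 𝓘(ℝ, Heis n) f p

/-- `(M, J, θ)`, immersed by `f`, is a pseudohermitian submanifold of `H_n`: `θ` is the restriction
of `Θ` (so that `ker θ = TM ∩ ker Θ`) and `J` is, on `ker θ`, the restriction of the standard CR
structure. -/
structure IsPseudohermitianSubmanifold (S : PseudohermitianStructure m M) (f : M → Heis n) :
    Prop where
  smooth : ContMDiff 𝓘(ℝ, PHModel m) 𝓘(ℝ, Heis n) ∞ f
  immersion : ∀ p : M, Function.Injective (diffAt (m := m) f p)
  θ_eq : ∀ (p : M) (v : TangentSpace 𝓘(ℝ, PHModel m) p), S.θ p v = Heis.Θ (f p) (diffAt f p v)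
  J_eq : ∀ (p : M) (v : TangentSpace 𝓘(ℝ, PHModel m) p), S.θ p v = 0 → diffAt f p (S.J p v) = Heis.J (f p) (diffAt f p v)

/-- `ν` is the fundamental vector field: `ν` is horizontal, orthogonal to `ker θ`, and `T + ν` is
tangent to `M`. -/
def IsFundamentalVectorField (S : PseudohermitianStructure m M) (f : M → Heis n)
    (ν : M → Heis n) : Prop :=
  ∀ p : M, Heis.Θ (f p) (ν p) = 0 ∧
    (∀ v : TangentSpace 𝓘(ℝ, PHModel m) p, S.θ p v = 0 → Heis.metric (f p) (ν p) (diffAt f p v) = 0) ∧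
    ∃ u : TangentSpace 𝓘(ℝ, PHModel m) p, diffAt f p u = Heis.T + ν p

/-- The holomorphic tangent space of `M` at `p`, that is the space of all `w ∈ ℂⁿ` such that
`∑ w_β Z_β` is tangent to `M`, where `Z_β = (e_β - i e_{n+β}) / 2`. -/
def holTangent (S : PseudohermitianStructure m M) (f : M → Heis n) (p : M) :
    Submodule ℂ (EuclideanSpace ℂ (Fin n)) :=
  Submodule.span ℂ {w | ∃ v : TangentSpace 𝓘(ℝ, PHModel m) p, S.θ p v = 0 ∧ w = (diffAt f p v).1}

/-- The second fundamental form at `p`. Let `W` be a section of the holomorphic tangent bundle (the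
field `∑ W_β Z_β`) and `v ∈ ker θ`, and put `Y = (v - i J v) / 2`. The value is the normal part of
`∇_Y W = ∑ (Y W_β) Z_β`, where `∇` is the pseudohermitian connection of `H_n`, for which the `Z_β` are
parallel. -/
def secondFundamentalForm (S : PseudohermitianStructure m M) (f : M → Heis n) (p : M)
    (v : TangentSpace 𝓘(ℝ, PHModel m) p) (W : M → EuclideanSpace ℂ (Fin n)) :
    EuclideanSpace ℂ (Fin n) :=
  let dW : TangentSpace 𝓘(ℝ, PHModel m) p →L[ℝ] EuclideanSpace ℂ (Fin n) :=
    mfderiv 𝓘(ℝ, PHModel m) 𝓘(ℝ, EuclideanSpace ℂ (Fin n)) W p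
  (holTangent S f p)ᗮ.starProjection ((1 / 2 : ℂ) • (dW v - Complex.I • dW (S.J p v)))

/-- The second fundamental form vanishes identically. -/
def SecondFundamentalFormVanishes (S : PseudohermitianStructure m M) (f : M → Heis n) : Prop :=
  ∀ (U : Set M) (W : M → EuclideanSpace ℂ (Fin n)), IsOpen U →
    ContMDiffOn 𝓘(ℝ, PHModel m) 𝓘(ℝ, EuclideanSpace ℂ (Fin n)) ∞ W U →
    (∀ q ∈ U, W q ∈ holTangent S f q) →
    ∀ p ∈ U, ∀ v, S.θ p v = 0 → secondFundamentalForm S f p v W = 0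

end Invariants

end

/-! Write `z` for the `ℂⁿ`-component of `f`, `w` for that of `ν`, and `ρ = ‖w‖²`. In a chart `θ = dt
+ Im ⟪z, dz⟫`, so `dθ = 2 Im ⟪dz, dz⟫`; the Reeb field `ξ` satisfies `dz ξ = w`; and `w` is complex
orthogonal to `dz (ker θ)`. Since `w ≠ 0`, the map `z` immerses `M` as a real hypersurface of `ℂⁿ`,
and `⟪w, dz⟫ = ρ θ` (`inner_w_dz`).

The exterior derivative of this identity controls `dw`. Modulo `w`, the (1,0)-part of `dw` on `ker
θ` is always `i ρ dz` (`inner_dw`); the free part is the (0,1)-part, recorded by `dbar w`, with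
values in the complex orthogonal complement of `w` (`inner_w_dbar`). In a unitary frame `g` of this
complement, with contact fields `X_k` such that `dz X_k = g_k`, the torsion coefficients are `⟪g_j,
dbar w X_k⟫ / 2` (`isConnection`). If `W` is a holomorphic tangent section, then differentiating
`⟪w, W⟫ = 0` shows that `II` is the pairing of `dbar w` with `W`, up to sign and a nonzero factor.
So torsion and `II` each vanish exactly when `dbar w = 0`.

Suppose `dbar w = 0`. Then on `ker θ` one has `dw = i ρ dz + (⟪w, dw⟫ / ρ) w`, and a further
exterior derivative forces `⟪w, dw⟫ = 0` there (`inner_w_dw`). Hence `dρ` annihilates the contact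
distribution; as `dθ` is nondegenerate on it, `ρ` is locally constant, and by the same argument so
is `w - i ρ z`. On the connected `M` this gives `ρ = c²` and `w = i c² (z - z₀)`, so that `‖z - z₀‖
= 1 / c`. Also `t + Im ⟪z₀, z⟫` is constant, and a left translation moves `M` into the sphere. There
`F` is a local homeomorphism by the inverse function theorem.

The Webster curvature comes from a Gauss equation for the connection forms `⟪g_j, dg_k⟫ - i ρ δ θ`:
the curvature tensor is `ρ (δ δ + δ δ)`, with trace `ρ (m + m²)`. -/

noncomputable section

local notation "⟪" x "," y "⟫" => inner ℂ x y

/-! ### Calculus of one-forms `⟪g, dφ⟫` -/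

section Calculus

variable {E : Type*} [NormedAddCommGroup E] [NormedSpace ℝ E]
  {F : Type*} [NormedAddCommGroup F] [NormedSpace ℝ F] {n : ℕ}

theorem two_le_infty : (2 : WithTop ℕ∞) ≤ ∞ := WithTop.coe_le_coe.2 le_top

theorem ofReal_im_eq (a : ℂ) : (a.im : ℂ) = -Complex.I / 2 * (a - conj a) := by
  rw [Complex.im_eq_sub_conj]
  field_simp
  linear_combination (a - conj a) * Complex.I_sq

theorem ofReal_im_neg_I_mul (a : ℂ) : ((-Complex.I * a).im : ℂ) = -(a + conj a) / 2 := by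
  rw [ofReal_im_eq]
  simp only [map_mul, map_neg, Complex.conj_I]
  linear_combination (a + conj a) / 2 * Complex.I_sq

theorem inner_self_eq_ofReal (a : EuclideanSpace ℂ (Fin n)) : ⟪a, a⟫ = ((‖a‖ ^ 2 : ℝ) : ℂ) := by
  rw [inner_self_eq_norm_sq_to_K]; push_cast; rfl

theorem fderiv_form_apply {α : E → E →L[ℝ] F} {x : E} (hα : DifferentiableAt ℝ α x) (u v : E) :
    fderiv ℝ (fun y => α y v) x u = fderiv ℝ α x u v := by
  rw [fderiv_clm_apply hα (differentiableAt_const v)]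
  simp

theorem fderiv_fderiv_comm {φ : E → F} {x : E} (hφ : ContDiffAt ℝ 2 φ x) (u v : E) :
    fderiv ℝ (fderiv ℝ φ) x u v = fderiv ℝ (fderiv ℝ φ) x v u :=
  (hφ.isSymmSndFDerivAt (by simp)).eq u v

theorem ContDiffAt.differentiableAt_fderiv {φ : E → F} {x : E} (hφ : ContDiffAt ℝ 2 φ x) :
    DifferentiableAt ℝ (fderiv ℝ φ) x :=
  (hφ.fderiv_right (m := 1) (by norm_num)).differentiableAt (by simp)

theorem fderiv_inner_fderiv {g φ : E → EuclideanSpace ℂ (Fin n)} {x : E}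
    (hg : DifferentiableAt ℝ g x) (hφ : ContDiffAt ℝ 2 φ x) (u v : E) :
    fderiv ℝ (fun y => ⟪g y, fderiv ℝ φ y v⟫) x u
      = ⟪g x, fderiv ℝ (fderiv ℝ φ) x u v⟫ + ⟪fderiv ℝ g x u, fderiv ℝ φ x v⟫ := by
  have h := hφ.differentiableAt_fderiv
  rw [fderiv_inner_apply ℂ hg (h.clm_apply (differentiableAt_const v)), fderiv_form_apply h]

/-- The antisymmetrized derivative of the one-form `⟪g, dφ⟫` is `⟪dg ∧ dφ⟫`. -/
theorem fderiv_inner_fderiv_sub {g φ : E → EuclideanSpace ℂ (Fin n)} {x : E}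
    (hg : DifferentiableAt ℝ g x) (hφ : ContDiffAt ℝ 2 φ x) (u v : E) :
    fderiv ℝ (fun y => ⟪g y, fderiv ℝ φ y v⟫) x u - fderiv ℝ (fun y => ⟪g y, fderiv ℝ φ y u⟫) x v
      = ⟪fderiv ℝ g x u, fderiv ℝ φ x v⟫ - ⟪fderiv ℝ g x v, fderiv ℝ φ x u⟫ := by
  rw [fderiv_inner_fderiv hg hφ, fderiv_inner_fderiv hg hφ, fderiv_fderiv_comm hφ]
  ring

/-- The one-form `⟪g, dφ⟫`. -/
def innerForm (g φ : E → EuclideanSpace ℂ (Fin n)) (x : E) : E →L[ℝ] ℂ :=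
  ((innerSL ℂ (g x)).restrictScalars ℝ).comp (fderiv ℝ φ x)

@[simp]
theorem innerForm_apply (g φ : E → EuclideanSpace ℂ (Fin n)) (x v : E) :
    innerForm g φ x v = ⟪g x, fderiv ℝ φ x v⟫ := rfl

theorem contDiffOn_fderiv_infty {φ : E → F} {V : Set E} (hV : IsOpen V)
    (hφ : ContDiffOn ℝ ∞ φ V) : ContDiffOn ℝ ∞ (fderiv ℝ φ) V :=
  hφ.fderiv_of_isOpen hV (by simp)

theorem contDiffOn_innerForm [FiniteDimensional ℝ E] {g φ : E → EuclideanSpace ℂ (Fin n)}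
    {V : Set E} (hV : IsOpen V) (hg : ContDiffOn ℝ ∞ g V) (hφ : ContDiffOn ℝ ∞ φ V) :
    ContDiffOn ℝ ∞ (innerForm g φ) V := by
  rw [contDiffOn_clm_apply]
  intro v
  exact hg.inner ℂ ((contDiffOn_fderiv_infty hV hφ).clm_apply contDiffOn_const)

theorem dForm_eq_of_eventuallyEq {α β : E → E →L[ℝ] F} {x : E} (h : α =ᶠ[𝓝 x] β) (u v : E) :
    dForm α x u v = dForm β x u v := by
  simp [dForm, h.fderiv_eq]

theorem dForm_innerForm [FiniteDimensional ℝ E] {g φ : E → EuclideanSpace ℂ (Fin n)} {V : Set E}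
    (hV : IsOpen V) (hg : ContDiffOn ℝ ∞ g V) (hφ : ContDiffOn ℝ ∞ φ V) {x : E} (hx : x ∈ V)
    (u v : E) :
    dForm (innerForm g φ) x u v
      = ⟪fderiv ℝ g x u, fderiv ℝ φ x v⟫ - ⟪fderiv ℝ g x v, fderiv ℝ φ x u⟫ := by
  have h : DifferentiableAt ℝ (innerForm g φ) x :=
    ((contDiffOn_innerForm hV hg hφ).contDiffAt (hV.mem_nhds hx)).differentiableAt (by simp)
  rw [dForm, ← fderiv_form_apply h, ← fderiv_form_apply h]
  exact fderiv_inner_fderiv_sub ((hg.contDiffAt (hV.mem_nhds hx)).differentiableAt (by simp))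
    ((hφ.contDiffAt (hV.mem_nhds hx)).of_le two_le_infty) u v

/-- Differentiating `⟪a, b⟫ = const`. -/
theorem inner_fderiv_of_const {a b : E → EuclideanSpace ℂ (Fin n)} {c : ℂ} {x : E}
    (ha : DifferentiableAt ℝ a x) (hb : DifferentiableAt ℝ b x) (h : ∀ᶠ y in 𝓝 x, ⟪a y, b y⟫ = c)
    (u : E) : ⟪fderiv ℝ a x u, b x⟫ = -⟪a x, fderiv ℝ b x u⟫ := by
  have h0 : fderiv ℝ (fun y => ⟪a y, b y⟫) x u = 0 := by
    rw [Filter.EventuallyEq.fderiv_eq (f := fun _ => c) h]; simp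
  rw [fderiv_inner_apply ℂ ha hb] at h0
  linear_combination h0

end Calculus

/-! ### Strictly pseudoconvex hypersurfaces in a chart -/

/-- The `ℂⁿ`-component `z` of a pseudohermitian submanifold of the Heisenberg group in a chart: an
immersed real hypersurface whose contact form `θ` satisfies `dθ = 2 Im ⟪dz, dz⟫`, with Reeb field `ξ`
and `w = dz ξ` orthogonal to the complex tangent spaces `dz (ker θ)`. -/
structure IsContactHypersurface {E : Type*} [NormedAddCommGroup E] [NormedSpace ℝ E] {n : ℕ}
    (V : Set E) (θ : E → E →L[ℝ] ℝ) (J : E → E →L[ℝ] E) (z w : E → EuclideanSpace ℂ (Fin n))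
    (ξ : E → E) : Prop where
  isOpen : IsOpen V
  smooth_z : ContDiffOn ℝ ∞ z V
  smooth_w : ContDiffOn ℝ ∞ w V
  smooth_θ : ContDiffOn ℝ ∞ θ V
  smooth_ξ : ContDiffOn ℝ ∞ ξ V
  smooth_J : ContDiffOn ℝ ∞ J V
  dθ : ∀ x ∈ V, ∀ u v, dForm θ x u v = 2 * (⟪fderiv ℝ z x u, fderiv ℝ z x v⟫).im
  θ_ξ : ∀ x ∈ V, θ x (ξ x) = 1
  z_ξ : ∀ x ∈ V, fderiv ℝ z x (ξ x) = w x
  θ_J : ∀ x ∈ V, ∀ v, θ x v = 0 → θ x (J x v) = 0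
  z_J : ∀ x ∈ V, ∀ v, θ x v = 0 → fderiv ℝ z x (J x v) = Complex.I • fderiv ℝ z x v
  J_J : ∀ x ∈ V, ∀ v, θ x v = 0 → J x (J x v) = -v
  orth : ∀ x ∈ V, ∀ v, θ x v = 0 → ⟪w x, fderiv ℝ z x v⟫ = 0
  w_ne : ∀ x ∈ V, w x ≠ 0
  inj : ∀ x ∈ V, ∀ v, fderiv ℝ z x v = 0 → v = 0
  surj : ∀ x ∈ V, ∀ h, ⟪w x, h⟫ = 0 → ∃ v, θ x v = 0 ∧ fderiv ℝ z x v = h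

/-- Twice the derivative of `w` in the direction of the `(0,1)`-part of `v`. -/
def dbar {E : Type*} [NormedAddCommGroup E] [NormedSpace ℝ E] {n : ℕ}
    (J : E → E →L[ℝ] E) (w : E → EuclideanSpace ℂ (Fin n)) (x v : E) : EuclideanSpace ℂ (Fin n) :=
  fderiv ℝ w x v + Complex.I • fderiv ℝ w x (J x v)

namespace IsContactHypersurface

variable {E : Type*} [NormedAddCommGroup E] [NormedSpace ℝ E] {n : ℕ}
  {V : Set E} {θ : E → E →L[ℝ] ℝ} {J : E → E →L[ℝ] E} {z w : E → EuclideanSpace ℂ (Fin n)}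
  {ξ : E → E} (H : IsContactHypersurface V θ J z w ξ) {x : E} (hx : x ∈ V)

include H hx

theorem eventually_mem : ∀ᶠ y in 𝓝 x, y ∈ V := H.isOpen.mem_nhds hx

theorem contDiffAt {F : Type*} [NormedAddCommGroup F] [NormedSpace ℝ F] {a : E → F}
    (ha : ContDiffOn ℝ ∞ a V) : ContDiffAt ℝ 2 a x :=
  (ha.contDiffAt (H.isOpen.mem_nhds hx)).of_le two_le_infty

theorem differentiableAt {F : Type*} [NormedAddCommGroup F] [NormedSpace ℝ F] {a : E → F}
    (ha : ContDiffOn ℝ ∞ a V) : DifferentiableAt ℝ a x :=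
  (H.contDiffAt hx ha).differentiableAt (by simp)

/-- Split off the Reeb component: on `ker θ` both sides vanish, on `ξ` both equal `‖w‖²`. The
exterior derivative of this identity is the source of everything known about `dw`. -/
theorem inner_w_dz (v : E) : ⟪w x, fderiv ℝ z x v⟫ = ((‖w x‖ ^ 2 * θ x v : ℝ) : ℂ) := by
  have h := H.orth x hx (v - θ x v • ξ x) (by simp [H.θ_ξ x hx])
  rw [map_sub, map_smul, H.z_ξ x hx, inner_sub_right, sub_eq_zero, ← Complex.coe_smul,
    inner_smul_right, inner_self_eq_norm_sq_to_K] at h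
  rw [h]; push_cast; simp; ring

theorem norm_w_pos : 0 < ‖w x‖ ^ 2 := by
  have := norm_pos_iff.2 (H.w_ne x hx); positivity

theorem fderiv_norm_sq (u : E) :
    ((fderiv ℝ (fun y => ‖w y‖ ^ 2) x u : ℝ) : ℂ)
      = ⟪w x, fderiv ℝ w x u⟫ + ⟪fderiv ℝ w x u, w x⟫ := by
  have hw := H.differentiableAt hx H.smooth_w
  have h1 : (fun y => ‖w y‖ ^ 2) = fun y => Complex.reCLM ⟪w y, w y⟫ := by
    funext y; simp [inner_self_eq_norm_sq_to_K, ← Complex.ofReal_pow]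
  have h2 : fderiv ℝ (fun y => Complex.reCLM ⟪w y, w y⟫) x u
      = Complex.reCLM (fderiv ℝ (fun y => ⟪w y, w y⟫) x u) := by
    have hd : DifferentiableAt ℝ (fun y => ⟪w y, w y⟫) x := hw.inner ℂ hw
    have := Complex.reCLM.hasFDerivAt.comp x hd.hasFDerivAt
    exact congrArg (fun L : E →L[ℝ] ℝ => L u) this.fderiv
  rw [h1, h2, fderiv_inner_apply ℂ hw hw, ← inner_conj_symm (fderiv ℝ w x u) (w x)]
  apply Complex.ext
  · simp
  · simp only [Complex.reCLM_apply, Complex.ofReal_im, Complex.add_im, Complex.conj_im]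
    rw [← inner_conj_symm (w x), Complex.conj_im]; ring

theorem differentiableAt_norm_sq : DifferentiableAt ℝ (fun y => ‖w y‖ ^ 2) x :=
  H.differentiableAt hx (H.smooth_w.norm_sq ℂ)

theorem dθ_eq (u v : E) : fderiv ℝ (fun y => θ y v) x u - fderiv ℝ (fun y => θ y u) x v
    = 2 * (⟪fderiv ℝ z x u, fderiv ℝ z x v⟫).im := by
  have h := H.differentiableAt hx H.smooth_θ
  rw [← H.dθ x hx, dForm, fderiv_form_apply h, fderiv_form_apply h]

theorem differentiableAt_θ (v : E) : DifferentiableAt ℝ (fun y => θ y v) x :=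
  (H.differentiableAt hx H.smooth_θ).clm_apply (differentiableAt_const v)

/-- The exterior derivative of `⟪w, dz⟫ = ‖w‖² θ`. -/
theorem dw_dz_sub (u v : E) :
    ⟪fderiv ℝ w x u, fderiv ℝ z x v⟫ - ⟪fderiv ℝ w x v, fderiv ℝ z x u⟫
      = ((fderiv ℝ (fun y => ‖w y‖ ^ 2) x u * θ x v - fderiv ℝ (fun y => ‖w y‖ ^ 2) x v * θ x u
        + 2 * ‖w x‖ ^ 2 * (⟪fderiv ℝ z x u, fderiv ℝ z x v⟫).im : ℝ) : ℂ) := by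
  have key : ∀ u v, fderiv ℝ (fun y => ⟪w y, fderiv ℝ z y v⟫) x u
      = ((fderiv ℝ (fun y => ‖w y‖ ^ 2) x u * θ x v
        + ‖w x‖ ^ 2 * fderiv ℝ (fun y => θ y v) x u : ℝ) : ℂ) := by
    intro u v
    have h1 : (fun y => ⟪w y, fderiv ℝ z y v⟫) =ᶠ[𝓝 x]
        fun y => Complex.ofRealCLM (‖w y‖ ^ 2 * θ y v) := by
      filter_upwards [H.eventually_mem hx] with y hy
      simpa using H.inner_w_dz hy v
    have h2 := (H.differentiableAt_norm_sq hx).hasFDerivAt.mul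
      (H.differentiableAt_θ hx v).hasFDerivAt
    have h3 := Complex.ofRealCLM.hasFDerivAt.comp x h2
    rw [h1.fderiv_eq]
    refine (congrArg (fun L : E →L[ℝ] ℂ => L u) h3.fderiv).trans ?_
    simp; ring
  rw [← fderiv_inner_fderiv_sub (H.differentiableAt hx H.smooth_w) (H.contDiffAt hx H.smooth_z),
    key, key, ← Complex.ofReal_sub]
  congr 1
  linear_combination ‖w x‖ ^ 2 * H.dθ_eq hx u v

/-- This is `dw_dz_sub` on the pair `(ξ, v)`. The `dθ` term drops out because `dz ξ = w` is
orthogonal to `dz v`, and the derivative of `‖w‖²` cancels against `⟪dw v, w⟫`. -/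
theorem dwξ_dz {v : E} (hv : θ x v = 0) :
    ⟪fderiv ℝ w x (ξ x), fderiv ℝ z x v⟫ = -⟪w x, fderiv ℝ w x v⟫ := by
  have h := H.dw_dz_sub hx (ξ x) v
  rw [hv, H.θ_ξ x hx, H.z_ξ x hx, H.orth x hx v hv] at h
  have h2 := H.fderiv_norm_sq hx v
  simp only [mul_zero, mul_one, zero_sub, Complex.zero_im, add_zero, Complex.ofReal_neg] at h
  linear_combination h - h2

/-- `dbar w` is tangent to the complex tangent space. -/
theorem inner_w_dbar {v : E} (hv : θ x v = 0) : ⟪w x, dbar J w x v⟫ = 0 := by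
  -- By `dwξ_dz`, on `ker θ` the form `⟪w, dw⟫` is complex linear with respect to `J`, so its
  -- (0,1)-part vanishes.
  have h1 := H.dwξ_dz hx hv
  have h2 := H.dwξ_dz hx (H.θ_J x hx v hv)
  rw [H.z_J x hx v hv, inner_smul_right] at h2
  rw [dbar, inner_add_right, inner_smul_right]
  linear_combination h1 + Complex.I * h2 - ⟪fderiv ℝ w x (ξ x), fderiv ℝ z x v⟫ * Complex.I_sq

/-- The `(1,0)`-part of the Weingarten map is multiplication by `i ‖w‖²`. -/
theorem inner_dw {v : E} (hv : θ x v = 0) {h : EuclideanSpace ℂ (Fin n)} (hh : ⟪w x, h⟫ = 0) :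
    ⟪h, fderiv ℝ w x v⟫ = Complex.I * (‖w x‖ ^ 2 : ℝ) * ⟪h, fderiv ℝ z x v⟫
      + 1 / 2 * ⟪h, dbar J w x v⟫ := by
  obtain ⟨u, hu, rfl⟩ := H.surj x hx h hh
  -- The unwanted term `⟪dw u, dz v⟫` is complex linear in `v`; combining the identities for `v` and
  -- `J v` after conjugation eliminates it.
  have e1 := H.dw_dz_sub hx v u
  have e2 := H.dw_dz_sub hx (J x v) u
  rw [H.z_J x hx v hv, inner_smul_right, inner_smul_left, H.θ_J x hx v hv] at e2
  rw [hv] at e1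
  rw [hu] at e1 e2
  have c1 := congrArg conj e1
  have c2 := congrArg conj e2
  simp only [map_sub, map_mul, inner_conj_symm, Complex.conj_ofReal, Complex.conj_I] at c1 c2
  rw [dbar, inner_add_right, inner_smul_right]
  simp only [mul_zero, sub_zero, zero_add, Complex.ofReal_mul, Complex.ofReal_ofNat] at c1 c2
  rw [ofReal_im_eq, inner_conj_symm] at c1
  rw [ofReal_im_neg_I_mul, inner_conj_symm] at c2
  linear_combination c1 / 2 - Complex.I / 2 * c2
    + ⟪fderiv ℝ z x v, fderiv ℝ w x u⟫ / 2 * Complex.I_sq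

end IsContactHypersurface

/-! ### Rigidity of hypersurfaces with `dbar w = 0` -/

namespace IsContactHypersurface

variable {E : Type*} [NormedAddCommGroup E] [NormedSpace ℝ E] {n : ℕ}
  {V : Set E} {θ : E → E →L[ℝ] ℝ} {J : E → E →L[ℝ] E} {z w : E → EuclideanSpace ℂ (Fin n)}
  {ξ : E → E} (H : IsContactHypersurface V θ J z w ξ) {x : E} (hx : x ∈ V)

include H hx

theorem im_inner_dz_J {v : E} (hv : θ x v = 0) :
    (⟪fderiv ℝ z x v, fderiv ℝ z x (J x v)⟫).im = ‖fderiv ℝ z x v‖ ^ 2 := by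
  rw [H.z_J x hx v hv, inner_smul_right, inner_self_eq_norm_sq_to_K]
  simp [← Complex.ofReal_pow]

/-- A function whose differential annihilates the contact distribution is locally constant. -/
theorem fderiv_eq_zero {F : Type*} [NormedAddCommGroup F] [NormedSpace ℝ F] {φ : E → F}
    (hφ : ContDiffOn ℝ ∞ φ V) (h : ∀ y ∈ V, ∀ v, θ y v = 0 → fderiv ℝ φ y v = 0)
    {v : E} (hv : θ x v = 0) (hv0 : v ≠ 0) : fderiv ℝ φ x = 0 := by
  -- Thus `dφ = κ θ` with `κ = dφ ξ`, and it remains to show `κ = 0`.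
  have hform : ∀ y ∈ V, ∀ u, fderiv ℝ φ y u = θ y u • fderiv ℝ φ y (ξ y) := by
    intro y hy u
    have := h y hy (u - θ y u • ξ y) (by simp [H.θ_ξ y hy])
    rwa [map_sub, map_smul, sub_eq_zero] at this
  have hφ2 := (H.contDiffAt hx hφ)
  have hd := hφ2.differentiableAt_fderiv
  have hκ : DifferentiableAt ℝ (fun y => fderiv ℝ φ y (ξ y)) x :=
    hd.clm_apply (H.differentiableAt hx H.smooth_ξ)
  have key : ∀ u₁ u₂, θ x u₂ = 0 → fderiv ℝ (fderiv ℝ φ) x u₁ u₂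
      = fderiv ℝ (fun y => θ y u₂) x u₁ • fderiv ℝ φ x (ξ x) := by
    intro u₁ u₂ hu
    rw [← fderiv_form_apply hd]
    have h1 : (fun y => fderiv ℝ φ y u₂) =ᶠ[𝓝 x] fun y => θ y u₂ • fderiv ℝ φ y (ξ y) := by
      filter_upwards [H.eventually_mem hx] with y hy using hform y hy u₂
    rw [h1.fderiv_eq, fderiv_fun_smul (H.differentiableAt_θ hx u₂) hκ]
    simp [hu]
  -- Symmetry of the second derivative says `d(κ θ)(v, J v) = 0`. As `θ` kills both vectors, only `κ
  -- dθ(v, J v) = 2 ‖dz v‖² κ` survives.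
  have h1 := key v (J x v) (H.θ_J x hx v hv)
  have h2 := key (J x v) v hv
  rw [fderiv_fderiv_comm hφ2, h2, ← sub_eq_zero, ← sub_smul, ← neg_sub, H.dθ_eq hx,
    H.im_inner_dz_J hx hv, smul_eq_zero, neg_eq_zero] at h1
  have h3 : ‖fderiv ℝ z x v‖ ≠ 0 := fun h0 => hv0 (H.inj x hx v (norm_eq_zero.1 h0))
  have h4 : fderiv ℝ φ x (ξ x) = 0 := h1.resolve_left (by positivity)
  ext u
  rw [hform x hx u, h4]; simp

variable (hD : ∀ y ∈ V, ∀ v, θ y v = 0 → dbar J w y v = 0)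
include hD

/-- When `dbar w = 0`, `inner_dw` determines every component of `dw v` orthogonal to `w`.
Accordingly the difference `e` of the two sides is orthogonal to `w`, hence to itself. -/
theorem dw_eq {v : E} (hv : θ x v = 0) :
    fderiv ℝ w x v = (Complex.I * (‖w x‖ ^ 2 : ℝ)) • fderiv ℝ z x v
      + (⟪w x, fderiv ℝ w x v⟫ / (‖w x‖ ^ 2 : ℝ)) • w x := by
  have hρ : ((‖w x‖ ^ 2 : ℝ) : ℂ) ≠ 0 := by exact_mod_cast (H.norm_w_pos hx).ne'
  set e := fderiv ℝ w x v - ((Complex.I * (‖w x‖ ^ 2 : ℝ)) • fderiv ℝ z x v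
      + (⟪w x, fderiv ℝ w x v⟫ / (‖w x‖ ^ 2 : ℝ)) • w x) with he
  have hwe : ⟪w x, e⟫ = 0 := by
    rw [he, inner_sub_right, inner_add_right, inner_smul_right, inner_smul_right,
      H.orth x hx v hv, inner_self_eq_ofReal]
    field_simp; ring
  have hew : ⟪e, w x⟫ = 0 := inner_eq_zero_symm.1 hwe
  have h1 := H.inner_dw hx hv hwe
  rw [hD x hx v hv, inner_zero_right, mul_zero, add_zero] at h1
  have h2 : ⟪e, e⟫ = 0 := by
    nth_rewrite 2 [he]
    rw [inner_sub_right, inner_add_right, inner_smul_right, inner_smul_right, h1, hew]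
    ring
  exact sub_eq_zero.1 (inner_self_eq_zero.1 h2)

omit H in
theorem dw_J {v : E} (hv : θ x v = 0) : fderiv ℝ w x (J x v) = Complex.I • fderiv ℝ w x v := by
  have h := congrArg (fun e => Complex.I • e) (hD x hx v hv)
  simp only [dbar, smul_add, smul_smul, Complex.I_mul_I, smul_zero, neg_smul, one_smul] at h
  rw [← sub_eq_zero, ← neg_eq_zero, neg_sub, sub_eq_add_neg]; exact h

/-- This is the integrability condition of `dw_eq`. For a field `G` orthogonal to `w` with `G x = dz
v`, one has `⟪G, dw⟫ = r ⟪G, dz⟫ + s θ` with `r = i ‖w‖²` and `s = ⟪G, dw ξ⟫`. The exterior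
derivative of both sides is evaluated on `(v, J v)`, where `ds ∧ θ` vanishes; what remains is a
nonzero multiple of `‖dz v‖² ⟪dw v, w⟫`. -/
theorem inner_w_dw {v : E} (hv : θ x v = 0) : ⟪w x, fderiv ℝ w x v⟫ = 0 := by
  by_cases hv0 : v = 0
  · simp [hv0]
  have hN : fderiv ℝ z x v ≠ 0 := fun h0 => hv0 (H.inj x hx v h0)
  have hρ : ∀ y ∈ V, ((‖w y‖ ^ 2 : ℝ) : ℂ) ≠ 0 := fun y hy => by
    exact_mod_cast (H.norm_w_pos hy).ne'
  have hdw := H.differentiableAt hx H.smooth_w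
  set h := fderiv ℝ z x v with hh
  -- The constant vector `h`, projected at each point to the complex orthogonal complement of `w`.
  set G : E → EuclideanSpace ℂ (Fin n) := fun y => h - (⟪w y, h⟫ / (‖w y‖ ^ 2 : ℝ)) • w y with hG
  have hGx : G x = h := by simp [hG, hh, H.orth x hx v hv]
  have hwG : ∀ y ∈ V, ⟪w y, G y⟫ = 0 := by
    intro y hy
    have := hρ y hy
    simp only [hG, inner_sub_right, inner_smul_right, inner_self_eq_ofReal]
    field_simp; ring
  have hdρ : DifferentiableAt ℝ (fun y => ((‖w y‖ ^ 2 : ℝ) : ℂ)) x :=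
    Complex.ofRealCLM.differentiableAt.comp x (H.differentiableAt_norm_sq hx)
  have hdc : DifferentiableAt ℝ (fun y => ⟪w y, h⟫ / ((‖w y‖ ^ 2 : ℝ) : ℂ)) x :=
    (hdw.inner ℂ (differentiableAt_const h)).fun_mul (hdρ.fun_inv (by exact hρ x hx))
  have hdG : DifferentiableAt ℝ G x := (differentiableAt_const h).sub (hdc.smul hdw)
  set s : E → ℂ := fun y => ⟪G y, fderiv ℝ w y (ξ y)⟫ with hs
  have hds : DifferentiableAt ℝ s x :=
    hdG.inner ℂ ((H.contDiffAt hx H.smooth_w).differentiableAt_fderiv.clm_apply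
      (H.differentiableAt hx H.smooth_ξ))
  set r : E → ℂ := fun y => Complex.I * ((‖w y‖ ^ 2 : ℝ) : ℂ) with hr
  have hdr : DifferentiableAt ℝ r x := hdρ.const_mul _
  have hform : ∀ y ∈ V, ∀ u, ⟪G y, fderiv ℝ w y u⟫
      = r y * ⟪G y, fderiv ℝ z y u⟫ + s y * ((θ y u : ℝ) : ℂ) := by
    intro y hy u
    have hu : θ y (u - θ y u • ξ y) = 0 := by simp [H.θ_ξ y hy]
    have h1 := H.inner_dw hy hu (hwG y hy)
    rw [hD y hy _ hu, inner_zero_right, mul_zero, add_zero, map_sub, map_sub, map_smul, map_smul,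
      H.z_ξ y hy, inner_sub_right, inner_sub_right, ← Complex.coe_smul, ← Complex.coe_smul,
      inner_smul_right, inner_smul_right, inner_eq_zero_symm.1 (hwG y hy)] at h1
    linear_combination h1
  have hdz := H.contDiffAt hx H.smooth_z
  have hdin : ∀ {φ : E → EuclideanSpace ℂ (Fin n)}, ContDiffAt ℝ 2 φ x → ∀ u,
      DifferentiableAt ℝ (fun y => ⟪G y, fderiv ℝ φ y u⟫) x := fun hφ u =>
    hdG.inner ℂ (hφ.differentiableAt_fderiv.clm_apply (differentiableAt_const u))
  have hdθ : ∀ u, DifferentiableAt ℝ (fun y => ((θ y u : ℝ) : ℂ)) x := fun u =>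
    Complex.ofRealCLM.differentiableAt.comp x (H.differentiableAt_θ hx u)
  have hdθ' : ∀ u u', fderiv ℝ (fun y => ((θ y u : ℝ) : ℂ)) x u'
      = (fderiv ℝ (fun y => θ y u) x u' : ℝ) := fun u u' =>
    congrArg (fun L : E →L[ℝ] ℂ => L u')
      (Complex.ofRealCLM.hasFDerivAt.comp x (H.differentiableAt_θ hx u).hasFDerivAt).fderiv
  have hdr' : ∀ u, fderiv ℝ r x u = Complex.I * (⟪w x, fderiv ℝ w x u⟫ + ⟪fderiv ℝ w x u, w x⟫) := by
    intro u
    rw [← H.fderiv_norm_sq hx u]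
    exact congrArg (fun L : E →L[ℝ] ℂ => L u) ((Complex.ofRealCLM.hasFDerivAt.comp x
      (H.differentiableAt_norm_sq hx).hasFDerivAt).const_mul Complex.I).fderiv
  have key : ∀ u₁ u₂, θ x u₂ = 0 → fderiv ℝ (fun y => ⟪G y, fderiv ℝ w y u₂⟫) x u₁
      = r x * fderiv ℝ (fun y => ⟪G y, fderiv ℝ z y u₂⟫) x u₁ + ⟪h, fderiv ℝ z x u₂⟫ * fderiv ℝ r x u₁
        + s x * (fderiv ℝ (fun y => θ y u₂) x u₁ : ℝ) := by
    intro u₁ u₂ hu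
    have h1 : (fun y => ⟪G y, fderiv ℝ w y u₂⟫) =ᶠ[𝓝 x]
        fun y => r y * ⟪G y, fderiv ℝ z y u₂⟫ + s y * ((θ y u₂ : ℝ) : ℂ) := by
      filter_upwards [H.eventually_mem hx] with y hy using hform y hy u₂
    rw [h1.fderiv_eq, fderiv_fun_add (hdr.fun_mul (hdin hdz u₂)) (hds.fun_mul (hdθ u₂)),
      fderiv_fun_mul hdr (hdin hdz u₂), fderiv_fun_mul hds (hdθ u₂)]
    simp [hu, hGx, hdθ']
  have hJ := H.θ_J x hx v hv
  have e1 := key v (J x v) hJ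
  have e2 := key (J x v) v hv
  have e3 := fderiv_inner_fderiv_sub hdG (H.contDiffAt hx H.smooth_w) v (J x v)
  have e4 := fderiv_inner_fderiv_sub hdG hdz v (J x v)
  have e5 := H.dθ_eq hx v (J x v)
  rw [H.im_inner_dz_J hx hv] at e5
  have e5' := congrArg (fun a : ℝ => (a : ℂ)) e5
  push_cast at e5'
  have hGw : ∀ u, ⟪fderiv ℝ G x u, w x⟫ = -⟪h, fderiv ℝ w x u⟫ := by
    intro u
    rw [← hGx]
    refine inner_fderiv_of_const (c := 0) hdG hdw ?_ u
    filter_upwards [H.eventually_mem hx] with y hy using inner_eq_zero_symm.1 (hwG y hy)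
  have hhh : ⟪h, h⟫ = ((‖h‖ : ℝ) : ℂ) ^ 2 := inner_self_eq_norm_sq_to_K h
  have hhdw : ⟪h, fderiv ℝ w x v⟫ = r x * ((‖h‖ : ℝ) : ℂ) ^ 2 := by
    have := H.inner_dw hx hv (H.orth x hx v hv)
    rwa [hD x hx v hv, inner_zero_right, mul_zero, add_zero, ← hh, hhh] at this
  have hsx : s x = -⟪fderiv ℝ w x v, w x⟫ := by
    have := congrArg conj (H.dwξ_dz hx hv)
    simp only [map_neg, inner_conj_symm] at this
    simp only [hs, hGx]
    exact this
  have hdwv : ∀ k, ⟪k, fderiv ℝ w x v⟫ = r x * ⟪k, h⟫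
      + (⟪w x, fderiv ℝ w x v⟫ / (‖w x‖ ^ 2 : ℝ)) * ⟪k, w x⟫ := by
    intro k
    conv_lhs => rw [H.dw_eq hx hD hv]
    rw [inner_add_right, inner_smul_right, inner_smul_right]
  -- After substituting `dw_eq`, the only contributions of `dG` not already in `r ⟪dG ∧ dz⟫` are
  -- multiples of `⟪dG, w⟫ = -⟪h, dw⟫`; those from `v` and `J v` cancel.
  have hdw1 := hdwv (fderiv ℝ G x v)
  have hdw2 := hdwv (fderiv ℝ G x (J x v))
  rw [hGw, hhdw] at hdw1
  rw [hGw, dw_J hx hD hv, inner_smul_right, hhdw] at hdw2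
  have hNpos : (((‖h‖ : ℝ) : ℂ) ^ 2) ≠ 0 := by simpa using hN
  clear_value r s h
  simp only [dw_J hx hD hv, H.z_J x hx v hv, inner_smul_right, inner_smul_left, 
    hhh, hdr', hsx, ← hh, Complex.conj_I] at e1 e2 e3 e4
  rw [hdw1, hdw2] at e3
  rw [← hh] at e5'
  -- The terms `dr ∧ ⟪G, dz⟫` and `s dθ` each contribute `-2 ‖h‖² ⟪dw v, w⟫`, which explains the
  -- division by 4.
  have h0 : (((‖h‖ : ℝ) : ℂ) ^ 2) * ⟪fderiv ℝ w x v, w x⟫ = 0 := by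
    linear_combination (e1 - e2 - e3 + r x * e4 - ⟪fderiv ℝ w x v, w x⟫ * e5'
      + 2 * (((‖h‖ : ℝ) : ℂ) ^ 2) * ⟪fderiv ℝ w x v, w x⟫ * Complex.I_sq) / 4
  exact inner_eq_zero_symm.1 ((mul_eq_zero.1 h0).resolve_left hNpos)

theorem fderiv_norm_sq_eq_zero {v : E} (hv : θ x v = 0) (hv0 : v ≠ 0) :
    fderiv ℝ (fun y => ‖w y‖ ^ 2) x = 0 := by
  refine H.fderiv_eq_zero hx (H.smooth_w.norm_sq ℂ) (fun y hy u hu => ?_) hv hv0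
  have := H.fderiv_norm_sq hy u
  rw [H.inner_w_dw hy hD hu, inner_eq_zero_symm.1 (H.inner_w_dw hy hD hu), add_zero] at this
  exact_mod_cast this

/-- If `dbar w = 0`, then `w - i ‖w‖² z` is locally constant. -/
theorem fderiv_sub_eq_zero (hne : ∀ y ∈ V, ∃ v, θ y v = 0 ∧ v ≠ 0) :
    fderiv ℝ (fun y => w y - (Complex.I * (‖w y‖ ^ 2 : ℝ)) • z y) x = 0 := by
  have hr : ContDiffOn ℝ ∞ (fun y => Complex.I * ((‖w y‖ ^ 2 : ℝ) : ℂ)) V :=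
    contDiffOn_const.mul (Complex.ofRealCLM.contDiff.comp_contDiffOn (H.smooth_w.norm_sq ℂ))
  obtain ⟨v, hv, hv0⟩ := hne x hx
  refine H.fderiv_eq_zero hx (H.smooth_w.sub (hr.smul H.smooth_z)) (fun y hy u hu => ?_) hv hv0
  obtain ⟨v', hv', hv0'⟩ := hne y hy
  have h0 := H.fderiv_norm_sq_eq_zero hy hD hv' hv0'
  have hr0 : fderiv ℝ (fun y => Complex.I * ((‖w y‖ ^ 2 : ℝ) : ℂ)) y = 0 := by
    have := (Complex.ofRealCLM.hasFDerivAt.comp y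
      (H.differentiableAt_norm_sq hy).hasFDerivAt).const_mul Complex.I
    refine this.fderiv.trans ?_
    refine ContinuousLinearMap.ext fun u' => ?_
    simp [h0]
  have hdr := H.differentiableAt hy hr
  have hdz := H.differentiableAt hy H.smooth_z
  rw [fderiv_fun_sub (H.differentiableAt hy H.smooth_w) (hdr.fun_smul hdz),
    fderiv_fun_smul hdr hdz, hr0]
  have hd := H.dw_eq hy hD hu
  rw [H.inner_w_dw hy hD hu, zero_div, zero_smul, add_zero] at hd
  simp [hd]

end IsContactHypersurface

/-! ### Unitary frames and admissible coframes -/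

/-- The solution of a linear system depending smoothly on parameters is smooth. -/
theorem exists_contDiffOn_solution {E F G : Type*} [NormedAddCommGroup E] [NormedSpace ℝ E]
    [NormedAddCommGroup F] [NormedSpace ℝ F] [NormedAddCommGroup G] [NormedSpace ℝ G]
    [FiniteDimensional ℝ F] [FiniteDimensional ℝ G] {V : Set E} (hV : IsOpen V)
    {A : E → F →L[ℝ] G} {b : E → G} (hA : ContDiffOn ℝ ∞ A V) (hb : ContDiffOn ℝ ∞ b V)
    (hdim : Module.finrank ℝ F = Module.finrank ℝ G) (hinj : ∀ x ∈ V, ∀ v, A x v = 0 → v = 0) :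
    ∃ X : E → F, ContDiffOn ℝ ∞ X V ∧ ∀ x ∈ V, A x (X x) = b x := by
  have heq : ∀ x ∈ V, ∃ e : F ≃L[ℝ] G, (e : F →L[ℝ] G) = A x := by
    intro x hx
    have h1 : Function.Injective (A x : F →ₗ[ℝ] G) :=
      (injective_iff_map_eq_zero _).2 (hinj x hx)
    refine ⟨(LinearEquiv.ofInjectiveOfFinrankEq (A x : F →ₗ[ℝ] G) h1
      hdim).toContinuousLinearEquiv, ?_⟩
    ext v; rfl
  -- `ContinuousLinearMap.inverse` is smooth at invertible maps. Its default value `0` at singular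
  -- ones can occur only off `V`.
  refine ⟨fun x => (A x).inverse (b x), fun x hx => ?_, fun x hx => ?_⟩
  · obtain ⟨e, he⟩ := heq x hx
    have h1 : ContDiffAt ℝ ∞ (fun y => (A y).inverse) x := by
      have : CompleteSpace F := FiniteDimensional.complete ℝ F
      have h2 : ContDiffAt ℝ ∞ ContinuousLinearMap.inverse (A x) := he ▸ contDiffAt_map_inverse e
      exact h2.comp x (hA.contDiffAt (hV.mem_nhds hx))
    exact (h1.clm_apply (hb.contDiffAt (hV.mem_nhds hx))).contDiffWithinAt
  · obtain ⟨e, he⟩ := heq x hx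
    simp [← he]

theorem finrank_real_euclideanSpace_complex (n : ℕ) :
    Module.finrank ℝ (EuclideanSpace ℂ (Fin n)) = 2 * n :=
  (finrank_real_of_complex (EuclideanSpace ℂ (Fin n))).trans (by simp)

/-- A smooth unitary frame of the complex orthogonal complement of `w`. -/
structure IsUnitaryFrame {E : Type*} [NormedAddCommGroup E] [NormedSpace ℝ E] {m n : ℕ}
    (V : Set E) (w : E → EuclideanSpace ℂ (Fin n)) (g : Fin m → E → EuclideanSpace ℂ (Fin n)) :
    Prop where
  smooth : ∀ k, ContDiffOn ℝ ∞ (g k) V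
  inner_eq : ∀ x ∈ V, ∀ j k, ⟪g j x, g k x⟫ = if j = k then 1 else 0
  orth : ∀ x ∈ V, ∀ k, ⟪w x, g k x⟫ = 0

/-- The vectors `w / ‖w‖, g_1, …, g_m` are `m + 1` orthonormal vectors, hence a basis. -/
theorem eq_sum_of_orthonormal {m : ℕ} {w : EuclideanSpace ℂ (Fin (m + 1))} (hw : w ≠ 0)
    {g : Fin m → EuclideanSpace ℂ (Fin (m + 1))}
    (hg : ∀ j k, ⟪g j, g k⟫ = if j = k then 1 else 0) (hwg : ∀ k, ⟪w, g k⟫ = 0)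
    (h : EuclideanSpace ℂ (Fin (m + 1))) :
    h = (⟪w, h⟫ / ((‖w‖ ^ 2 : ℝ) : ℂ)) • w + ∑ k, ⟪g k, h⟫ • g k := by
  have hw' : (‖w‖ : ℂ) ≠ 0 := by simpa using hw
  set b : Fin (m + 1) → EuclideanSpace ℂ (Fin (m + 1)) :=
    Fin.cons ((‖w‖ : ℂ)⁻¹ • w) g with hb
  have ho : Orthonormal ℂ b := by
    rw [orthonormal_iff_ite]
    intro i j
    refine Fin.cases ?_ (fun i => ?_) i <;> refine Fin.cases ?_ (fun j => ?_) j
    · simp only [hb, Fin.cons_zero, inner_smul_left, inner_smul_right, inner_self_eq_ofReal]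
      push_cast
      simp only [map_inv₀, Complex.conj_ofReal]
      field_simp
    · simp [hb, inner_smul_left, hwg, (Fin.succ_ne_zero j).symm]
    · simp [hb, inner_smul_right, inner_eq_zero_symm.1 (hwg i), Fin.succ_ne_zero i]
    · simp [hb, hg]
  let B := (basisOfOrthonormalOfCardEqFinrank ho (by simp)).toOrthonormalBasis (by simpa using ho)
  have hB : ∀ i, B i = b i := fun i => by simp [B]
  have h1 := B.sum_repr' h
  simp only [hB, Fin.sum_univ_succ, hb, Fin.cons_zero, Fin.cons_succ, inner_smul_left,
    smul_smul] at h1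
  conv_lhs => rw [← h1]
  congr 2
  push_cast
  simp only [map_inv₀, Complex.conj_ofReal]
  field_simp

theorem inner_eq_sum_of_orthonormal {m : ℕ} {w : EuclideanSpace ℂ (Fin (m + 1))} (hw : w ≠ 0)
    {g : Fin m → EuclideanSpace ℂ (Fin (m + 1))}
    (hg : ∀ j k, ⟪g j, g k⟫ = if j = k then 1 else 0) (hwg : ∀ k, ⟪w, g k⟫ = 0)
    (a b : EuclideanSpace ℂ (Fin (m + 1))) :
    ⟪a, b⟫ = ⟪a, w⟫ * ⟪w, b⟫ / ((‖w‖ ^ 2 : ℝ) : ℂ) + ∑ k, ⟪a, g k⟫ * ⟪g k, b⟫ := by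
  conv_lhs => rw [eq_sum_of_orthonormal hw hg hwg b]
  rw [inner_add_right, inner_smul_right, inner_sum]
  simp only [inner_smul_right]
  congr 1
  · ring
  · exact Finset.sum_congr rfl fun k _ => mul_comm _ _

/-- Pairing with `w` gives `‖w‖² (α v + i s) = 0`, and real and imaginary parts separate. With `L =
dz` and `α = θ`, the normal direction `i w` completes `dz` to the square system `(v, s) ↦ dz v + s i
w`; the lemma gives its injectivity and shows that targets orthogonal to `w` have preimages with `s
= 0` and `v` in `ker θ`. -/
theorem eq_zero_of_add_smul {E : Type*} [NormedAddCommGroup E] [NormedSpace ℝ E] {n : ℕ}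
    {L : E →L[ℝ] EuclideanSpace ℂ (Fin n)} {α : E →L[ℝ] ℝ} {w : EuclideanSpace ℂ (Fin n)}
    (hw : w ≠ 0) (hL : ∀ v, ⟪w, L v⟫ = ((‖w‖ ^ 2 * α v : ℝ) : ℂ)) {v : E} {s : ℝ}
    {h : EuclideanSpace ℂ (Fin n)} (hh : ⟪w, h⟫ = 0) (heq : L v + s • (Complex.I • w) = h) :
    α v = 0 ∧ s = 0 := by
  have hρ : ‖w‖ ^ 2 ≠ 0 := by simpa using hw
  rw [← heq, inner_add_right, hL, ← Complex.coe_smul, inner_smul_right,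
    inner_smul_right, inner_self_eq_ofReal] at hh
  generalize ‖w‖ ^ 2 = ρ at hh hρ
  have h1 := congrArg Complex.re hh
  have h2 := congrArg Complex.im hh
  simp [hρ] at h1 h2
  exact ⟨h1, h2⟩

/-- A real hyperplane transversal to `i w` contains the complex orthogonal complement of `w`. -/
theorem exists_eq_of_inner_eq_zero {E : Type*} [NormedAddCommGroup E] [NormedSpace ℝ E]
    [FiniteDimensional ℝ E] {n : ℕ}
    {L : E →L[ℝ] EuclideanSpace ℂ (Fin n)} {α : E →L[ℝ] ℝ} {w : EuclideanSpace ℂ (Fin n)}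
    (hw : w ≠ 0) (hL : ∀ v, ⟪w, L v⟫ = ((‖w‖ ^ 2 * α v : ℝ) : ℂ)) (hinj : ∀ v, L v = 0 → v = 0)
    (hdim : Module.finrank ℝ E + 1 = 2 * n) {h : EuclideanSpace ℂ (Fin n)} (hh : ⟪w, h⟫ = 0) :
    ∃ v, α v = 0 ∧ L v = h := by
  set A : (E × ℝ) →L[ℝ] EuclideanSpace ℂ (Fin n) :=
    L.coprod (ContinuousLinearMap.toSpanSingleton ℝ (Complex.I • w)) with hA
  have hAinj : Function.Injective (A : E × ℝ →ₗ[ℝ] EuclideanSpace ℂ (Fin n)) := by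
    refine (injective_iff_map_eq_zero _).2 ?_
    rintro ⟨v, s⟩ h0
    change L v + s • (Complex.I • w) = 0 at h0
    obtain ⟨-, hs⟩ := eq_zero_of_add_smul hw hL (inner_zero_right _) h0
    rw [hs, zero_smul, add_zero] at h0
    rw [hinj v h0, hs]; rfl
  have hsurj := (LinearMap.injective_iff_surjective_of_finrank_eq_finrank (by
    rw [finrank_real_euclideanSpace_complex, Module.finrank_prod, Module.finrank_self, hdim])).1
    hAinj
  obtain ⟨⟨v, s⟩, hv⟩ := hsurj h
  change L v + s • (Complex.I • w) = h at hv
  obtain ⟨h1, hs⟩ := eq_zero_of_add_smul hw hL hh hv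
  exact ⟨v, h1, by rw [← hv, hs]; simp⟩

namespace IsContactHypersurface

variable {m : ℕ} {V : Set (PHModel m)} {θ : PHModel m → PHModel m →L[ℝ] ℝ}
  {J : PHModel m → PHModel m →L[ℝ] PHModel m} {z w : PHModel m → EuclideanSpace ℂ (Fin (m + 1))}
  {ξ : PHModel m → PHModel m} (H : IsContactHypersurface V θ J z w ξ)
  {g : Fin m → PHModel m → EuclideanSpace ℂ (Fin (m + 1))}
  {ϑ : Fin m → PHModel m → PHModel m →L[ℝ] ℂ}

include H

/-- The vector fields in the contact distribution which correspond to a unitary frame. -/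
theorem exists_dual (hg : IsUnitaryFrame V w g) :
    ∃ X : Fin m → PHModel m → PHModel m, (∀ k, ContDiffOn ℝ ∞ (X k) V) ∧
      ∀ k, ∀ x ∈ V, θ x (X k x) = 0 ∧ fderiv ℝ z x (X k x) = g k x := by
  set A : PHModel m → (PHModel m × ℝ) →L[ℝ] EuclideanSpace ℂ (Fin (m + 1)) := fun x =>
    (fderiv ℝ z x).coprod (ContinuousLinearMap.toSpanSingleton ℝ (Complex.I • w x)) with hAdef
  have hA : ContDiffOn ℝ ∞ A V := by
    rw [contDiffOn_clm_apply]
    rintro ⟨v, s⟩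
    simp only [A, ContinuousLinearMap.coprod_apply, ContinuousLinearMap.toSpanSingleton_apply]
    exact ((contDiffOn_fderiv_infty H.isOpen H.smooth_z).clm_apply contDiffOn_const).add
      ((H.smooth_w.const_smul Complex.I).const_smul s)
  have hdim : Module.finrank ℝ (PHModel m × ℝ)
      = Module.finrank ℝ (EuclideanSpace ℂ (Fin (m + 1))) := by
    rw [finrank_real_euclideanSpace_complex]
    simp; ring
  have hsol : ∀ k, ∃ X : PHModel m → PHModel m × ℝ, ContDiffOn ℝ ∞ X V ∧
      ∀ x ∈ V, A x (X x) = g k x := fun k => by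
    refine exists_contDiffOn_solution H.isOpen hA (hg.smooth k) hdim ?_
    rintro x hx ⟨v, s⟩ h
    simp only [A, ContinuousLinearMap.coprod_apply,
      ContinuousLinearMap.toSpanSingleton_apply] at h
    obtain ⟨-, hs⟩ := eq_zero_of_add_smul (H.w_ne x hx) (H.inner_w_dz hx) (inner_zero_right _) h
    rw [hs, zero_smul, add_zero] at h
    rw [H.inj x hx v h, hs]; rfl
  choose X hX hAX using hsol
  refine ⟨fun k x => (X k x).1, fun k => (hX k).fst, fun k x hx => ?_⟩
  have h := hAX k x hx
  simp only [A, ContinuousLinearMap.coprod_apply,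
    ContinuousLinearMap.toSpanSingleton_apply] at h
  obtain ⟨h1, hs⟩ := eq_zero_of_add_smul (H.w_ne x hx) (H.inner_w_dz hx) (hg.orth x hx k) h
  exact ⟨h1, by rw [← h, hs]; simp⟩

theorem inner_dz_eq_sum (hg : IsUnitaryFrame V w g) {x : PHModel m} (hx : x ∈ V)
    (v u : PHModel m) : ⟪fderiv ℝ z x v, fderiv ℝ z x u⟫
      = ((‖w x‖ ^ 2 * θ x v * θ x u : ℝ) : ℂ)
        + ∑ k, ⟪fderiv ℝ z x v, g k x⟫ * ⟪g k x, fderiv ℝ z x u⟫ := by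
  rw [inner_eq_sum_of_orthonormal (H.w_ne x hx) (hg.inner_eq x hx) (hg.orth x hx),
    ← inner_conj_symm (fderiv ℝ z x v) (w x), H.inner_w_dz hx, H.inner_w_dz hx,
    Complex.conj_ofReal]
  have hρ : ((‖w x‖ ^ 2 : ℝ) : ℂ) ≠ 0 := by exact_mod_cast (H.norm_w_pos hx).ne'
  congr 1
  push_cast at hρ ⊢
  field_simp

/-- The admissible coframe of a unitary frame. -/
theorem isAdmissibleCoframe (hg : IsUnitaryFrame V w g) :
    IsAdmissibleCoframe V θ J (fun k => innerForm (g k) z) where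
  smooth j := contDiffOn_innerForm H.isOpen (hg.smooth j) H.smooth_z
  type_one_zero x hx j v hv := by
    rw [innerForm_apply, innerForm_apply, H.z_J x hx v hv, inner_smul_right]
  coframe x hx v hv h := by
    apply H.inj x hx
    rw [eq_sum_of_orthonormal (H.w_ne x hx) (hg.inner_eq x hx) (hg.orth x hx)
      (fderiv ℝ z x v), H.orth x hx v hv]
    simp only [innerForm_apply] at h
    simp [h]
  levi x hx v u := by
    have h1 := H.inner_dz_eq_sum hg hx v u
    have h2 := congrArg conj h1
    simp only [map_add, map_sum, map_mul, inner_conj_symm, Complex.conj_ofReal] at h2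
    rw [H.dθ x hx, Complex.ofReal_mul, ofReal_im_eq, inner_conj_symm, h1,
      ← inner_conj_symm, h1]
    simp only [map_add, map_sum, map_mul, inner_conj_symm, Complex.conj_ofReal, wedge, conjForm,
      ContinuousLinearMap.comp_apply, innerForm_apply, ContinuousLinearEquiv.coe_coe,
      Complex.conjCLE_apply, Finset.sum_sub_distrib]
    have h3 : ∑ k, ⟪fderiv ℝ z x v, g k x⟫ * ⟪g k x, fderiv ℝ z x u⟫
      = ∑ k, ⟪g k x, fderiv ℝ z x u⟫ * ⟪fderiv ℝ z x v, g k x⟫ :=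
      Finset.sum_congr rfl fun k _ => mul_comm _ _
    rw [h3]
    push_cast
    ring

/-- Every admissible coframe comes from a unitary frame. -/
theorem exists_unitaryFrame (hϑ : IsAdmissibleCoframe V θ J ϑ) :
    ∃ g : Fin m → PHModel m → EuclideanSpace ℂ (Fin (m + 1)), IsUnitaryFrame V w g ∧
      ∀ x ∈ V, ∀ k v, ϑ k x v = ⟪g k x, fderiv ℝ z x v⟫ := by
  -- The frame is `g_k = dz X_k`, where the `X_k` in `ker θ` are dual to the coframe: `ϑ_j X_k =
  -- δ_jk`.
  set A : PHModel m → PHModel m →L[ℝ] (ℝ × (Fin m → ℂ)) := fun x =>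
    (θ x).prod (ContinuousLinearMap.pi fun k => ϑ k x) with hAdef
  have hA : ContDiffOn ℝ ∞ A V := by
    rw [contDiffOn_clm_apply]
    intro v
    refine (H.smooth_θ.clm_apply contDiffOn_const).prodMk (contDiffOn_pi.2 fun k => ?_)
    exact (hϑ.smooth k).clm_apply contDiffOn_const
  have hdim : Module.finrank ℝ (PHModel m) = Module.finrank ℝ (ℝ × (Fin m → ℂ)) := by
    simp [Module.finrank_pi_fintype, Complex.finrank_real_complex]; ring
  have hsol : ∀ k, ∃ X : PHModel m → PHModel m, ContDiffOn ℝ ∞ X V ∧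
      ∀ x ∈ V, A x (X x) = (0, Pi.single k 1) := fun k => by
    refine exists_contDiffOn_solution H.isOpen hA contDiffOn_const hdim ?_
    intro x hx v h
    have h1 := Prod.ext_iff.1 h
    exact hϑ.coframe x hx v h1.1 fun j => congrFun h1.2 j
  choose X hX hAX using hsol
  have hθX : ∀ k, ∀ x ∈ V, θ x (X k x) = 0 := fun k x hx => (Prod.ext_iff.1 (hAX k x hx)).1
  have hϑX : ∀ k j, ∀ x ∈ V, ϑ j x (X k x) = if j = k then 1 else 0 := fun k j x hx => by
    have := congrFun (Prod.ext_iff.1 (hAX k x hx)).2 j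
    exact this.trans (Pi.single_apply k (1 : ℂ) j)
  have hlevi : ∀ x ∈ V, ∀ v u, ⟪fderiv ℝ z x v, fderiv ℝ z x u⟫ - ⟪fderiv ℝ z x u, fderiv ℝ z x v⟫
      = ∑ k, conj (ϑ k x v) * ϑ k x u - ∑ k, conj (ϑ k x u) * ϑ k x v := by
    intro x hx v u
    have h1 := hϑ.levi x hx v u
    rw [H.dθ x hx, Complex.ofReal_mul, ofReal_im_eq, inner_conj_symm] at h1
    simp only [wedge, conjForm, ContinuousLinearMap.comp_apply, ContinuousLinearEquiv.coe_coe,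
      Complex.conjCLE_apply, Finset.sum_sub_distrib] at h1
    push_cast at h1
    have h2 : ∀ a b : PHModel m, ∑ k, ϑ k x a * conj (ϑ k x b)
        = ∑ k, conj (ϑ k x b) * ϑ k x a := fun a b => Finset.sum_congr rfl fun k _ => mul_comm _ _
    rw [h2, h2] at h1
    have h3 : Complex.I ≠ 0 := Complex.I_ne_zero
    apply mul_left_cancel₀ h3
    linear_combination -h1
  -- The Levi identity gives only the imaginary part of the Hermitian form; replacing `u` by `J u`
  -- gives the real part.
  have hinner : ∀ x ∈ V, ∀ v u, θ x u = 0 → 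
      ⟪fderiv ℝ z x v, fderiv ℝ z x u⟫ = ∑ k, conj (ϑ k x v) * ϑ k x u := by
    intro x hx v u hu
    have h1 := hlevi x hx v u
    have h2 := hlevi x hx v (J x u)
    rw [H.z_J x hx u hu, inner_smul_right, inner_smul_left] at h2
    simp only [hϑ.type_one_zero x hx _ u hu, map_mul, Complex.conj_I, mul_assoc,
      mul_left_comm _ Complex.I, ← Finset.mul_sum, neg_mul, Finset.sum_neg_distrib] at h2
    linear_combination h1 / 2 - Complex.I / 2 * h2
      + (⟪fderiv ℝ z x v, fderiv ℝ z x u⟫ + ⟪fderiv ℝ z x u, fderiv ℝ z x v⟫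
        - ∑ k, conj (ϑ k x v) * ϑ k x u - ∑ k, conj (ϑ k x u) * ϑ k x v) / 2 * Complex.I_sq
  have hval : ∀ x ∈ V, ∀ k v, ϑ k x v = ⟪fderiv ℝ z x (X k x), fderiv ℝ z x v⟫ := by
    intro x hx k v
    rw [← inner_conj_symm, hinner x hx v _ (hθX k x hx)]
    simp [hϑX _ _ x hx]
  refine ⟨fun k x => fderiv ℝ z x (X k x), ⟨fun k => ?_, fun x hx j k => ?_, fun x hx k => ?_⟩, hval⟩
  · exact (contDiffOn_fderiv_infty H.isOpen H.smooth_z).clm_apply (hX k)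
  · rw [← hval x hx, hϑX k j x hx]
  · exact H.orth x hx _ (hθX k x hx)

end IsContactHypersurface

/-! ### The Tanaka-Webster connection of a hypersurface -/

/-- The connection forms `⟪g_j, dg_k⟫ - i ‖w‖² δ θ` of a unitary frame. -/
def frameConnection {m n : ℕ} (θ : PHModel m → PHModel m →L[ℝ] ℝ)
    (w : PHModel m → EuclideanSpace ℂ (Fin n)) (g : Fin m → PHModel m → EuclideanSpace ℂ (Fin n))
    (k j : Fin m) (x : PHModel m) : PHModel m →L[ℝ] ℂ :=
  innerForm (g j) (g k) x
    - (if j = k then Complex.I * ((‖w x‖ ^ 2 : ℝ) : ℂ) else 0) • toComplexForm (θ x)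

namespace IsContactHypersurface

variable {m : ℕ} {V : Set (PHModel m)} {θ : PHModel m → PHModel m →L[ℝ] ℝ}
  {J : PHModel m → PHModel m →L[ℝ] PHModel m} {z w : PHModel m → EuclideanSpace ℂ (Fin (m + 1))}
  {ξ : PHModel m → PHModel m} (H : IsContactHypersurface V θ J z w ξ)
  {g : Fin m → PHModel m → EuclideanSpace ℂ (Fin (m + 1))}
  {ϑ : Fin m → PHModel m → PHModel m →L[ℝ] ℂ}

include H

theorem dbar_J {x v : PHModel m} (hx : x ∈ V) (hv : θ x v = 0) :
    dbar J w x (J x v) = -Complex.I • dbar J w x v := by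
  simp only [dbar, H.J_J x hx v hv, map_neg, smul_add, smul_smul, neg_mul, Complex.I_mul_I,
    smul_neg, neg_smul]
  simp [add_comm]

/-- `dbar w` in terms of its values on the frame. -/
theorem dbar_eq_sum (hg : IsUnitaryFrame V w g) {X : Fin m → PHModel m} {x : PHModel m}
    (hx : x ∈ V) (hX : ∀ k, θ x (X k) = 0 ∧ fderiv ℝ z x (X k) = g k x) {v : PHModel m}
    (hv : θ x v = 0) :
    dbar J w x v = ∑ k, ⟪fderiv ℝ z x v, g k x⟫ • dbar J w x (X k) := by
  have hv2 : v = ∑ k, ((⟪g k x, fderiv ℝ z x v⟫).re • X k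
      + (⟪g k x, fderiv ℝ z x v⟫).im • J x (X k)) := by
    rw [← sub_eq_zero]
    apply H.inj x hx
    rw [map_sub, map_sum, sub_eq_zero]
    conv_lhs => rw [eq_sum_of_orthonormal (H.w_ne x hx) (hg.inner_eq x hx) (hg.orth x hx)
      (fderiv ℝ z x v), H.orth x hx v hv, zero_div, zero_smul, zero_add]
    refine Finset.sum_congr rfl fun k _ => ?_
    rw [map_add, map_smul, map_smul, H.z_J x hx _ (hX k).1, (hX k).2, ← Complex.coe_smul,
      ← Complex.coe_smul, smul_smul, ← add_smul, Complex.re_add_im]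
  -- `dbar w` is conjugate linear, so the coefficient `⟪g_k, dz v⟫` comes out conjugated.
  have hlin : ∀ k, dbar J w x ((⟪g k x, fderiv ℝ z x v⟫).re • X k
      + (⟪g k x, fderiv ℝ z x v⟫).im • J x (X k))
      = ⟪fderiv ℝ z x v, g k x⟫ • dbar J w x (X k) := by
    intro k
    have h1 := H.dbar_J hx (hX k).1
    rw [← inner_conj_symm (fderiv ℝ z x v)]
    generalize ⟪g k x, fderiv ℝ z x v⟫ = c
    have hc : conj c = (c.re : ℂ) + (c.im : ℂ) * -Complex.I := by apply Complex.ext <;> simp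
    have h2 : ∀ a b : ℝ, ∀ p q, dbar J w x (a • p + b • q)
        = (a : ℂ) • dbar J w x p + (b : ℂ) • dbar J w x q := by
      intro a b p q
      simp only [dbar, map_add, map_smul, smul_add, Complex.coe_smul, smul_comm Complex.I]
      abel
    rw [h2, h1, smul_smul, ← add_smul, hc]
  have hsum : ∀ Y : Fin m → PHModel m, dbar J w x (∑ k, Y k) = ∑ k, dbar J w x (Y k) := by
    intro Y
    simp [dbar, Finset.sum_add_distrib, Finset.smul_sum]
  conv_lhs => rw [hv2, hsum]
  exact Finset.sum_congr rfl fun k _ => hlin k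

theorem fderiv_frame_w (hg : IsUnitaryFrame V w g) {x : PHModel m} (hx : x ∈ V) (k : Fin m)
    (u : PHModel m) : ⟪fderiv ℝ (g k) x u, w x⟫ = -⟪g k x, fderiv ℝ w x u⟫ := by
  refine inner_fderiv_of_const (c := 0) (H.differentiableAt hx (hg.smooth k))
    (H.differentiableAt hx H.smooth_w) ?_ u
  filter_upwards [H.eventually_mem hx] with y hy using inner_eq_zero_symm.1 (hg.orth y hy k)

theorem fderiv_frame (hg : IsUnitaryFrame V w g) {x : PHModel m} (hx : x ∈ V) (j k : Fin m)
    (u : PHModel m) : ⟪fderiv ℝ (g j) x u, g k x⟫ = -⟪g j x, fderiv ℝ (g k) x u⟫ := by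
  refine inner_fderiv_of_const (c := if j = k then 1 else 0) (H.differentiableAt hx (hg.smooth j))
    (H.differentiableAt hx (hg.smooth k)) ?_ u
  filter_upwards [H.eventually_mem hx] with y hy using hg.inner_eq y hy j k

omit H in
theorem frameConnection_apply (k j : Fin m) (x v : PHModel m) :
    frameConnection θ w g k j x v = ⟪g j x, fderiv ℝ (g k) x v⟫
      - (if j = k then Complex.I * ((‖w x‖ ^ 2 : ℝ) : ℂ) else 0) * ((θ x v : ℝ) : ℂ) := rfl

theorem contDiffOn_frameConnection (hg : IsUnitaryFrame V w g) (k j : Fin m) :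
    ContDiffOn ℝ ∞ (frameConnection θ w g k j) V := by
  have h1 : ContDiffOn ℝ ∞
      (fun x => if j = k then Complex.I * ((‖w x‖ ^ 2 : ℝ) : ℂ) else 0) V := by
    split_ifs
    · exact contDiffOn_const.mul
        (Complex.ofRealCLM.contDiff.comp_contDiffOn (H.smooth_w.norm_sq ℂ))
    · exact contDiffOn_const
  rw [contDiffOn_clm_apply]
  intro v
  exact ((contDiffOn_innerForm H.isOpen (hg.smooth j) (hg.smooth k)).clm_apply
    contDiffOn_const).sub (h1.mul (Complex.ofRealCLM.contDiff.comp_contDiffOn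
      (H.smooth_θ.clm_apply contDiffOn_const)))

/-- The Tanaka-Webster connection and torsion of the coframe of a unitary frame. -/
theorem isConnection (hg : IsUnitaryFrame V w g) {X : Fin m → PHModel m → PHModel m}
    (hXs : ∀ k, ContDiffOn ℝ ∞ (X k) V)
    (hX : ∀ k, ∀ x ∈ V, θ x (X k x) = 0 ∧ fderiv ℝ z x (X k x) = g k x) :
    IsConnection V θ (fun k => innerForm (g k) z) (frameConnection θ w g)
      (fun j k x => 1 / 2 * ⟪g j x, dbar J w x (X k x)⟫) where
  smooth_φ k j := H.contDiffOn_frameConnection hg k j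
  smooth_A j k := by
    have h1 := contDiffOn_fderiv_infty H.isOpen H.smooth_w
    exact contDiffOn_const.mul ((hg.smooth j).inner ℂ ((h1.clm_apply (hXs k)).add
      ((h1.clm_apply (H.smooth_J.clm_apply (hXs k))).const_smul Complex.I)))
  skew x hx k j := by
    ext v
    simp only [add_apply, conjForm, ContinuousLinearMap.comp_apply,
      ContinuousLinearEquiv.coe_coe, Complex.conjCLE_apply, frameConnection_apply, map_sub, map_mul,
      inner_conj_symm, Complex.conj_ofReal, H.fderiv_frame hg hx, zero_apply]
    by_cases h : j = k
    · simp [h]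
    · simp [h, Ne.symm h]
  structure_eq x hx j v u := by
    rw [dForm_innerForm H.isOpen (hg.smooth j) H.smooth_z hx]
    -- Expand `⟪dg_j b, dz a⟫` in the basis `w, g_k`. Its `w`-component produces the term `θ ⟪g_j,
    -- dw⟫`, since `⟪dg_j, w⟫ = -⟪g_j, dw⟫`.
    have hsum : ∀ a b : PHModel m, ∑ k, ⟪g k x, fderiv ℝ z x a⟫ * frameConnection θ w g k j x b
        = -⟪fderiv ℝ (g j) x b, fderiv ℝ z x a⟫ - (θ x a : ℂ) * ⟪g j x, fderiv ℝ w x b⟫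
          - Complex.I * ((‖w x‖ ^ 2 : ℝ) : ℂ) * (θ x b : ℂ) * ⟪g j x, fderiv ℝ z x a⟫ := by
      intro a b
      have hρ : ((‖w x‖ ^ 2 : ℝ) : ℂ) ≠ 0 := by exact_mod_cast (H.norm_w_pos hx).ne'
      rw [inner_eq_sum_of_orthonormal (H.w_ne x hx) (hg.inner_eq x hx) (hg.orth x hx)
        (fderiv ℝ (g j) x b), H.fderiv_frame_w hg hx, H.inner_w_dz hx]
      simp only [frameConnection_apply, mul_sub, Finset.sum_sub_distrib, H.fderiv_frame hg hx]
      simp only [ite_mul, mul_ite, zero_mul, mul_zero, Finset.sum_ite_eq, Finset.mem_univ, if_true]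
      rw [Complex.ofReal_mul, neg_mul, neg_div, mul_left_comm (⟪g j x, fderiv ℝ w x b⟫),
        mul_div_cancel_left₀ _ hρ]
      have hcomm : ∑ k, ⟪g k x, fderiv ℝ z x a⟫ * ⟪g j x, fderiv ℝ (g k) x b⟫
          = ∑ k, ⟪g j x, fderiv ℝ (g k) x b⟫ * ⟪g k x, fderiv ℝ z x a⟫ :=
        Finset.sum_congr rfl fun k _ => mul_comm _ _
      simp only [neg_mul, Finset.sum_neg_distrib, hcomm]
      ring
    -- So `τʲ` is `⟪g_j, dw⟫` without its (1,0)-part and its Reeb part. In the structure equation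
    -- the (1,0)-part is absorbed by the summand `-i ‖w‖² δ θ` of the connection, and the Reeb part
    -- disappears in `θ ∧ τʲ`.
    have htors : ∀ a : PHModel m, torsionForm (fun k => innerForm (g k) z)
        (fun j k x => 1 / 2 * ⟪g j x, dbar J w x (X k x)⟫) j x a
        = ⟪g j x, fderiv ℝ w x a⟫ - Complex.I * ((‖w x‖ ^ 2 : ℝ) : ℂ) * ⟪g j x, fderiv ℝ z x a⟫
          - (θ x a : ℂ) * ⟪g j x, fderiv ℝ w x (ξ x)⟫ := by
      intro a
      have hb : θ x (a - θ x a • ξ x) = 0 := by simp [H.θ_ξ x hx]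
      have h1 := H.inner_dw hx hb (hg.orth x hx j)
      have h2 := H.dbar_eq_sum hg hx (fun k => hX k x hx) hb
      have h3 : ∀ k, ⟪fderiv ℝ z x (a - θ x a • ξ x), g k x⟫ = ⟪fderiv ℝ z x a, g k x⟫ := by
        intro k
        rw [map_sub, map_smul, H.z_ξ x hx, inner_sub_left, ← Complex.coe_smul, inner_smul_left,
          hg.orth x hx]
        simp
      simp only [h3] at h2
      rw [h2, inner_sum, ← inner_conj_symm _ (fderiv ℝ z x _), h3, inner_conj_symm, map_sub,
        map_smul, inner_sub_right, ← Complex.coe_smul, inner_smul_right] at h1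
      simp only [inner_smul_right] at h1
      simp only [torsionForm, conjForm, sum_apply,
        smul_apply, ContinuousLinearMap.comp_apply,
        ContinuousLinearEquiv.coe_coe, Complex.conjCLE_apply, innerForm_apply, inner_conj_symm,
        smul_eq_mul]
      rw [Finset.mul_sum] at h1
      have h4 : ∑ k, 1 / 2 * ⟪g j x, dbar J w x (X k x)⟫ * ⟪fderiv ℝ z x a, g k x⟫
          = ∑ k, 1 / 2 * (⟪fderiv ℝ z x a, g k x⟫ * ⟪g j x, dbar J w x (X k x)⟫) :=
        Finset.sum_congr rfl fun k _ => by ring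
      rw [h4]
      linear_combination -h1
    simp only [wedge, innerForm_apply, Finset.sum_sub_distrib, hsum, htors, toComplexForm,
      ContinuousLinearMap.comp_apply, Complex.ofRealCLM_apply]
    ring

end IsContactHypersurface

/-! ### Uniqueness of the connection, and the Webster curvature -/

namespace IsContactHypersurface

variable {m : ℕ} {V : Set (PHModel m)} {θ : PHModel m → PHModel m →L[ℝ] ℝ}
  {J : PHModel m → PHModel m →L[ℝ] PHModel m} {z w : PHModel m → EuclideanSpace ℂ (Fin (m + 1))}
  {ξ : PHModel m → PHModel m} (H : IsContactHypersurface V θ J z w ξ)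
  {g : Fin m → PHModel m → EuclideanSpace ℂ (Fin (m + 1))}
  {ϑ : Fin m → PHModel m → PHModel m →L[ℝ] ℂ}

include H

/-- The Tanaka-Webster connection and torsion are unique. -/
theorem connection_unique (hg : IsUnitaryFrame V w g)
    (hϑ : ∀ x ∈ V, ∀ k v, ϑ k x v = ⟪g k x, fderiv ℝ z x v⟫)
    {φ ψ : Fin m → Fin m → PHModel m → PHModel m →L[ℝ] ℂ} {A B : Fin m → Fin m → PHModel m → ℂ}
    (hφ : IsConnection V θ ϑ φ A) (hψ : IsConnection V θ ϑ ψ B) {x : PHModel m} (hx : x ∈ V) :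
    (∀ k j, φ k j x = ψ k j x) ∧ ∀ j k, A j k x = B j k x := by
  obtain ⟨X, -, hX⟩ := H.exists_dual hg
  have hϑξ : ∀ k, ϑ k x (ξ x) = 0 := fun k => by
    rw [hϑ x hx, H.z_ξ x hx, inner_eq_zero_symm.1 (hg.orth x hx k)]
  have hϑX : ∀ k l, ϑ k x (X l x) = if k = l then 1 else 0 := fun k l => by
    rw [hϑ x hx, (hX l x hx).2, hg.inner_eq x hx]
  have hϑJ : ∀ k v, θ x v = 0 → ϑ k x (J x v) = Complex.I * ϑ k x v := fun k v hv => by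
    rw [hϑ x hx, hϑ x hx, H.z_J x hx v hv, inner_smul_right]
  have heq : ∀ j v u, ∑ k, wedge (ϑ k x) (φ k j x) v u
      + wedge (toComplexForm (θ x)) (torsionForm ϑ A j x) v u
      = ∑ k, wedge (ϑ k x) (ψ k j x) v u
      + wedge (toComplexForm (θ x)) (torsionForm ϑ B j x) v u := fun j v u => by
    rw [← hφ.structure_eq x hx, ← hψ.structure_eq x hx]
  simp only [wedge, torsionForm, toComplexForm, conjForm, sum_apply, smul_apply,
    ContinuousLinearMap.comp_apply, ContinuousLinearEquiv.coe_coe, Complex.conjCLE_apply,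
    Complex.ofRealCLM_apply, smul_eq_mul] at heq
  -- On `(ξ, u)` with `u` in `ker θ`, the connection terms with `φ(ξ)` are complex linear in `u` and
  -- the torsion terms conjugate linear. The values `u = X_l` and `u = J X_l` separate them.
  have hξ : ∀ j l, φ l j x (ξ x) = ψ l j x (ξ x) ∧ A j l x = B j l x := by
    intro j l
    have h1 := heq j (ξ x) (X l x)
    have h2 := heq j (ξ x) (J x (X l x))
    simp [hϑξ, hϑJ _ _ (hX l x hx).1, H.θ_J x hx _ (hX l x hx).1, hϑX, (hX l x hx).1,
      H.θ_ξ x hx, apply_ite (starRingEnd ℂ)] at h1 h2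
    constructor
    · linear_combination -h1 / 2 + Complex.I / 2 * h2
        + (φ l j x (ξ x) + A j l x - ψ l j x (ξ x) - B j l x) / 2 * Complex.I_sq
    · linear_combination h1 / 2 + Complex.I / 2 * h2
        + (φ l j x (ξ x) + A j l x - ψ l j x (ξ x) - B j l x) / 2 * Complex.I_sq
  have hhor : ∀ l j u, θ x u = 0 → φ l j x u - ψ l j x u
      = ∑ k, ϑ k x u * (φ k j x (X l x) - ψ k j x (X l x)) := by
    intro l j u hu
    have h1 := heq j (X l x) u
    simp [hϑX, (hX l x hx).1, hu, Finset.sum_sub_distrib] at h1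
    simp only [mul_sub, Finset.sum_sub_distrib]
    linear_combination h1
  -- By `hhor`, `φ - ψ` restricted to `ker θ` is of type (1,0). Skew-hermitian symmetry makes it of
  -- type (0,1) as well, hence zero.
  have hJ : ∀ l j u, θ x u = 0 → φ l j x (J x u) - ψ l j x (J x u)
      = Complex.I * (φ l j x u - ψ l j x u) := by
    intro l j u hu
    rw [hhor l j u hu, hhor l j _ (H.θ_J x hx u hu), Finset.mul_sum]
    exact Finset.sum_congr rfl fun k _ => by rw [hϑJ k u hu]; ring
  have hskew : ∀ l j u, φ l j x u - ψ l j x u = -conj (φ j l x u - ψ j l x u) := by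
    intro l j u
    have h1 := congrArg (fun L : PHModel m →L[ℝ] ℂ => L u) (hφ.skew x hx l j)
    have h2 := congrArg (fun L : PHModel m →L[ℝ] ℂ => L u) (hψ.skew x hx l j)
    simp only [add_apply, conjForm, ContinuousLinearMap.comp_apply, ContinuousLinearEquiv.coe_coe,
      Complex.conjCLE_apply, zero_apply] at h1 h2
    rw [map_sub]
    linear_combination h1 - h2
  refine ⟨fun k j => ?_, fun j k => (hξ j k).2⟩
  have hzero : ∀ u, θ x u = 0 → φ k j x u = ψ k j x u := by
    intro u hu
    have h1 := hskew k j (J x u)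
    rw [hJ k j u hu, hJ j k u hu, map_mul, Complex.conj_I, hskew k j u] at h1
    have h2 : Complex.I ≠ 0 := Complex.I_ne_zero
    have h3 : Complex.I * (φ k j x u - ψ k j x u) = 0 := by
      rw [hskew k j u]; linear_combination h1 / 2
    exact sub_eq_zero.1 ((mul_eq_zero.1 h3).resolve_left h2)
  ext u
  have h1 := hzero (u - θ x u • ξ x) (by simp [H.θ_ξ x hx])
  rw [map_sub, map_sub, map_smul, map_smul, (hξ j k).1] at h1
  exact sub_left_injective h1

/-- The curvature of the connection of a frame if `dbar w = 0`. -/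
theorem curvature_frame (hg : IsUnitaryFrame V w g) {x : PHModel m} (hx : x ∈ V)
    (hD : ∀ y ∈ V, ∀ v, θ y v = 0 → dbar J w y v = 0) (k j : Fin m)
    {v u : PHModel m} (hv : θ x v = 0) (hu : θ x u = 0) :
    dForm (frameConnection θ w g k j) x v u
      - ∑ l, wedge (frameConnection θ w g k l x) (frameConnection θ w g l j x) v u
      = ((‖w x‖ ^ 2 : ℝ) : ℂ) * (wedge (innerForm (g j) z x) (conjForm (innerForm (g k) z x)) v u
        + if j = k then
          ∑ p, wedge (innerForm (g p) z x) (conjForm (innerForm (g p) z x)) v u else 0) := by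
  have hρ : ((‖w x‖ ^ 2 : ℝ) : ℂ) ≠ 0 := by exact_mod_cast (H.norm_w_pos hx).ne'
  have hgd : ∀ k, DifferentiableAt ℝ (g k) x := fun k => H.differentiableAt hx (hg.smooth k)
  have hdr : DifferentiableAt ℝ
      (fun y => if j = k then Complex.I * ((‖w y‖ ^ 2 : ℝ) : ℂ) else 0) x := by
    split_ifs
    · exact (Complex.ofRealCLM.differentiableAt.comp x (H.differentiableAt_norm_sq hx)).const_mul _
    · exact differentiableAt_const _
  -- The derivative of `‖w‖²` does not enter, being multiplied by `θ a = 0`.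
  have hfd : ∀ a b, θ x a = 0 → fderiv ℝ (frameConnection θ w g k j) x b a
      = fderiv ℝ (innerForm (g j) (g k)) x b a
        - (if j = k then Complex.I * ((‖w x‖ ^ 2 : ℝ) : ℂ) else 0)
          * ((fderiv ℝ (fun y => θ y a) x b : ℝ) : ℂ) := by
    intro a b ha
    have hi : DifferentiableAt ℝ (innerForm (g j) (g k)) x := H.differentiableAt hx
      (contDiffOn_innerForm H.isOpen (hg.smooth j) (hg.smooth k))
    have hθa := Complex.ofRealCLM.hasFDerivAt.comp x (H.differentiableAt_θ hx a).hasFDerivAt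
    rw [← fderiv_form_apply (H.differentiableAt hx (H.contDiffOn_frameConnection hg k j)),
      ← fderiv_form_apply hi]
    have h1 := (hi.clm_apply (differentiableAt_const a)).hasFDerivAt.sub
      (hdr.hasFDerivAt.mul hθa)
    refine (congrArg (fun L : PHModel m →L[ℝ] ℂ => L b) h1.fderiv).trans ?_
    by_cases hjk : j = k <;> simp [ha, hjk]
  have hdθ := congrArg (fun a : ℝ => (a : ℂ)) (H.dθ_eq hx v u)
  simp only [Complex.ofReal_sub, Complex.ofReal_mul, ofReal_im_eq, inner_conj_symm] at hdθ
  have hdi := dForm_innerForm H.isOpen (hg.smooth j) (hg.smooth k) hx v u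
  rw [dForm] at hdi
  have hwg : ∀ i, ∀ a, θ x a = 0 → ⟪fderiv ℝ (g i) x a, w x⟫
      = -(Complex.I * ((‖w x‖ ^ 2 : ℝ) : ℂ) * ⟪g i x, fderiv ℝ z x a⟫) := by
    intro i a ha
    rw [H.fderiv_frame_w hg hx, H.inner_dw hx ha (hg.orth x hx i), hD x hx a ha]
    simp
  have hgw : ∀ i, ∀ a, θ x a = 0 → ⟪w x, fderiv ℝ (g i) x a⟫
      = Complex.I * ((‖w x‖ ^ 2 : ℝ) : ℂ) * ⟪fderiv ℝ z x a, g i x⟫ := by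
    intro i a ha
    rw [← inner_conj_symm, hwg i a ha]
    simp only [map_neg, map_mul, Complex.conj_I, Complex.conj_ofReal, inner_conj_symm]
    ring
  -- The Gauss equation: the tangential part of `⟪dg_j, dg_k⟫` is the quadratic connection term. The
  -- normal part, by `hwg` and `hgw`, carries the factor `‖w‖⁴ / ‖w‖² = ‖w‖²`.
  have hsum : ∀ a b, θ x a = 0 → θ x b = 0 →
      ∑ l, frameConnection θ w g k l x a * frameConnection θ w g l j x b
      = -⟪fderiv ℝ (g j) x b, fderiv ℝ (g k) x a⟫
        + ((‖w x‖ ^ 2 : ℝ) : ℂ) * ⟪g j x, fderiv ℝ z x b⟫ * ⟪fderiv ℝ z x a, g k x⟫ := by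
    intro a b ha hb
    rw [inner_eq_sum_of_orthonormal (H.w_ne x hx) (hg.inner_eq x hx) (hg.orth x hx)
        (fderiv ℝ (g j) x b), hwg j b hb, hgw k a ha]
    simp only [frameConnection_apply, ha, hb, Complex.ofReal_zero, mul_zero, sub_zero,
      H.fderiv_frame hg hx j]
    have hcomm : ∑ l, ⟪g l x, fderiv ℝ (g k) x a⟫ * ⟪g j x, fderiv ℝ (g l) x b⟫
          = ∑ l, ⟪g j x, fderiv ℝ (g l) x b⟫ * ⟪g l x, fderiv ℝ (g k) x a⟫ :=
        Finset.sum_congr rfl fun k _ => mul_comm _ _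
    simp only [neg_mul, Finset.sum_neg_distrib, hcomm]
    field_simp
    linear_combination (-⟪g j x, fderiv ℝ z x b⟫ * ⟪fderiv ℝ z x a, g k x⟫ *
      ((‖w x‖ ^ 2 : ℝ) : ℂ)) * Complex.I_sq
  have hP : ∀ a b, θ x a = 0 → ⟪fderiv ℝ z x a, fderiv ℝ z x b⟫
      = ∑ k, ⟪fderiv ℝ z x a, g k x⟫ * ⟪g k x, fderiv ℝ z x b⟫ := by
    intro a b ha
    rw [H.inner_dz_eq_sum hg hx, ha]; simp
  rw [hP v u hv, hP u v hu] at hdθ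
  rw [dForm, hfd u v hu, hfd v u hv]
  simp only [wedge, Finset.sum_sub_distrib, hsum v u hv hu, hsum u v hu hv, conjForm,
    ContinuousLinearMap.comp_apply, ContinuousLinearEquiv.coe_coe, Complex.conjCLE_apply,
    innerForm_apply, inner_conj_symm]
  have hcomm : ∀ a b : PHModel m, ∑ k, ⟪fderiv ℝ z x a, g k x⟫ * ⟪g k x, fderiv ℝ z x b⟫
      = ∑ k, ⟪g k x, fderiv ℝ z x b⟫ * ⟪fderiv ℝ z x a, g k x⟫ := fun a b =>
    Finset.sum_congr rfl fun k _ => mul_comm _ _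
  rw [hcomm, hcomm] at hdθ
  push_cast at hdθ ⊢
  -- For `j = k` the extra trace term comes from `-i ‖w‖² dθ`, with `dθ = i ∑ ϑᵖ ∧ ϑ^{p̄}` on `ker
  -- θ`.
  split_ifs with hjk
  · linear_combination hdi - Complex.I * ((‖w x‖ : ℂ) ^ 2) * hdθ
      + (‖w x‖ : ℂ) ^ 2 * (∑ k, ⟪g k x, fderiv ℝ z x u⟫ * ⟪fderiv ℝ z x v, g k x⟫
        - ∑ k, ⟪g k x, fderiv ℝ z x v⟫ * ⟪fderiv ℝ z x u, g k x⟫) * Complex.I_sq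
  · linear_combination hdi

end IsContactHypersurface

/-! ### Torsion and Webster scalar curvature of hypersurfaces -/

theorem IsConnection.congr {m : ℕ} {V : Set (PHModel m)} (hV : IsOpen V)
    {θ : PHModel m → PHModel m →L[ℝ] ℝ} {ϑ η : Fin m → PHModel m → PHModel m →L[ℝ] ℂ} (h : ∀ x ∈ V, ∀ k, ϑ k x = η k x)
    {φ : Fin m → Fin m → PHModel m → PHModel m →L[ℝ] ℂ} {A : Fin m → Fin m → PHModel m → ℂ}
    (hη : IsConnection V θ η φ A) : IsConnection V θ ϑ φ A where
  smooth_φ := hη.smooth_φ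
  smooth_A := hη.smooth_A
  skew := hη.skew
  structure_eq x hx j v u := by
    have h1 : ϑ j =ᶠ[𝓝 x] η j := by
      filter_upwards [hV.mem_nhds hx] with y hy using h y hy j
    have h2 := hη.structure_eq x hx j v u
    simp only [torsionForm] at h2 ⊢
    rw [dForm_eq_of_eventuallyEq h1, h2]
    simp only [h x hx]

namespace IsContactHypersurface

theorem mono {E : Type*} [NormedAddCommGroup E] [NormedSpace ℝ E] {n : ℕ}
    {V V' : Set E} {θ : E → E →L[ℝ] ℝ} {J : E → E →L[ℝ] E} {z w : E → EuclideanSpace ℂ (Fin n)}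
    {ξ : E → E} (H : IsContactHypersurface V θ J z w ξ) (hV' : IsOpen V') (h : V' ⊆ V) :
    IsContactHypersurface V' θ J z w ξ where
  isOpen := hV'
  smooth_z := H.smooth_z.mono h
  smooth_w := H.smooth_w.mono h
  smooth_θ := H.smooth_θ.mono h
  smooth_ξ := H.smooth_ξ.mono h
  smooth_J := H.smooth_J.mono h
  dθ x hx := H.dθ x (h hx)
  θ_ξ x hx := H.θ_ξ x (h hx)
  z_ξ x hx := H.z_ξ x (h hx)
  θ_J x hx := H.θ_J x (h hx)
  z_J x hx := H.z_J x (h hx)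
  J_J x hx := H.J_J x (h hx)
  orth x hx := H.orth x (h hx)
  w_ne x hx := H.w_ne x (h hx)
  inj x hx := H.inj x (h hx)
  surj x hx := H.surj x (h hx)

variable {m : ℕ} {V : Set (PHModel m)} {θ : PHModel m → PHModel m →L[ℝ] ℝ}
  {J : PHModel m → PHModel m →L[ℝ] PHModel m} {z w : PHModel m → EuclideanSpace ℂ (Fin (m + 1))}
  {ξ : PHModel m → PHModel m} (H : IsContactHypersurface V θ J z w ξ)
  {g : Fin m → PHModel m → EuclideanSpace ℂ (Fin (m + 1))}
  {ϑ : Fin m → PHModel m → PHModel m →L[ℝ] ℂ}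

include H

/-- Unitary frames exist locally. -/
theorem exists_local_frame {x₀ : PHModel m} (hx₀ : x₀ ∈ V) : ∃ V' ⊆ V, IsOpen V' ∧ x₀ ∈ V' ∧
    ∃ g : Fin m → PHModel m → EuclideanSpace ℂ (Fin (m + 1)), IsUnitaryFrame V' w g := by
  set b : PHModel m → EuclideanSpace ℂ (Fin (m + 1)) := fun y => ((‖w y‖)⁻¹ : ℝ) • w y with hb
  have hbs : ContDiffOn ℝ ∞ b V :=
    ((H.smooth_w.norm ℂ H.w_ne).inv fun x hx => norm_ne_zero_iff.2 (H.w_ne x hx)).smul H.smooth_w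
  have hbb : ∀ y ∈ V, ⟪b y, b y⟫ = 1 := fun y hy => by
    have h1 : ‖b y‖ = 1 := by
      rw [hb]; simp only [norm_smul, norm_inv, norm_norm]
      exact inv_mul_cancel₀ (norm_ne_zero_iff.2 (H.w_ne y hy))
    rw [inner_self_eq_ofReal, h1]; simp
  have hwb : ∀ y ∈ V, w y = (‖w y‖ : ℂ) • b y := fun y hy => by
    have h1 : (‖w y‖ : ℂ) ≠ 0 := by simpa using H.w_ne y hy
    rw [hb]
    simp only [← Complex.coe_smul, smul_smul]
    push_cast
    rw [mul_inv_cancel₀ h1, one_smul]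
  set a := b x₀ with ha
  have ha0 : a ≠ 0 := fun h => by
    have := hbb x₀ hx₀
    rw [← ha, h] at this; simp at this
  have : Fact (Module.finrank ℂ (EuclideanSpace ℂ (Fin (m + 1))) = m + 1) := ⟨by simp⟩
  let B := OrthonormalBasis.fromOrthogonalSpanSingleton (𝕜 := ℂ) m ha0
  set e : Fin m → EuclideanSpace ℂ (Fin (m + 1)) := fun k => (B k : EuclideanSpace ℂ (Fin (m + 1)))
    with he
  have hee : ∀ j k, ⟪e j, e k⟫ = if j = k then 1 else 0 := fun j k => by
    have := orthonormal_iff_ite.1 B.orthonormal j k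
    rwa [Submodule.coe_inner] at this
  have hae : ∀ k, ⟪a, e k⟫ = 0 := fun k =>
    Submodule.mem_orthogonal_singleton_iff_inner_right.1 (B k).2
  have hea : ∀ k, ⟪e k, a⟫ = 0 := fun k => inner_eq_zero_symm.1 (hae k)
  have hDs : ContDiffOn ℝ ∞ (fun y => 1 + ⟪b y, a⟫) V :=
    contDiffOn_const.add (hbs.inner ℂ contDiffOn_const)
  -- The orthonormal basis `e` of the complement of `a` is carried to the complement of `b y` by the
  -- formula for the rotation taking `a` to `b y`. It requires `1 + ⟪b y, a⟫ ≠ 0`, an open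
  -- condition; at `x₀` the value is 2.
  refine ⟨V ∩ (fun y => 1 + ⟪b y, a⟫) ⁻¹' {0}ᶜ, inter_subset_left,
    hDs.continuousOn.isOpen_inter_preimage H.isOpen isOpen_compl_singleton,
    ⟨hx₀, by
      have h1 : ⟪b x₀, a⟫ = 1 := hbb x₀ hx₀
      simp [h1, one_add_one_eq_two]⟩,
    fun k y => e k - (⟪b y, e k⟫ / (1 + ⟪b y, a⟫)) • (a + b y), ⟨fun k => ?_, ?_, ?_⟩⟩
  · have hD : ∀ y ∈ V ∩ (fun y => 1 + ⟪b y, a⟫) ⁻¹' {0}ᶜ, 1 + ⟪b y, a⟫ ≠ 0 := fun y hy => hy.2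
    have hbs' := hbs.mono (inter_subset_left (s := V) (t := (fun y => 1 + ⟪b y, a⟫) ⁻¹' {0}ᶜ))
    have hc : ContDiffOn ℝ ∞ (fun y => ⟪b y, e k⟫ / (1 + ⟪b y, a⟫))
        (V ∩ (fun y => 1 + ⟪b y, a⟫) ⁻¹' {0}ᶜ) := by
      simp only [div_eq_mul_inv]
      exact (hbs'.inner ℂ contDiffOn_const).mul ((hDs.mono inter_subset_left).inv hD)
    exact contDiffOn_const.sub (hc.smul (contDiffOn_const.add hbs'))
  · rintro y ⟨hy, hD⟩ j k
    have hD1 : 1 + ⟪b y, a⟫ ≠ 0 := hD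
    have hD2 : 1 + ⟪a, b y⟫ ≠ 0 := fun h => hD1 (by
      have := congrArg conj h
      simpa using this)
    simp only [inner_sub_left, inner_sub_right, inner_smul_left, inner_smul_right, inner_add_left,
      inner_add_right, hee, hae, hea, hbb y hy, map_div₀, map_add, map_one, inner_conj_symm]
    have haa : ⟪a, a⟫ = 1 := hbb x₀ hx₀
    rw [haa]
    field_simp
    ring
  · rintro y ⟨hy, hD⟩ k
    have hD1 : 1 + ⟪b y, a⟫ ≠ 0 := hD
    rw [hwb y hy, inner_smul_left, inner_sub_right, inner_smul_right, inner_add_right, hbb y hy]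
    field_simp
    ring

/-- If the torsion vanishes for the coframes on `V` then `dbar w = 0`. -/
theorem dbar_eq_zero_of_torsion (hg : IsUnitaryFrame V w g)
    (hT : ∀ ϑ φ A, IsAdmissibleCoframe V θ J ϑ → IsConnection V θ ϑ φ A →
      ∀ x ∈ V, ∀ j k, A j k x = 0) :
    ∀ x ∈ V, ∀ v, θ x v = 0 → dbar J w x v = 0 := by
  intro x hx v hv
  obtain ⟨X, hXs, hX⟩ := H.exists_dual hg
  have hA := hT _ _ _ (H.isAdmissibleCoframe hg) (H.isConnection hg hXs hX) x hx
  rw [H.dbar_eq_sum hg hx (fun k => hX k x hx) hv]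
  refine Finset.sum_eq_zero fun k _ => ?_
  rw [eq_sum_of_orthonormal (H.w_ne x hx) (hg.inner_eq x hx) (hg.orth x hx) (dbar J w x (X k x)),
    H.inner_w_dbar hx (hX k x hx).1]
  have h0 : ∀ j, ⟪g j x, dbar J w x (X k x)⟫ = 0 := fun j => by simpa using hA j k
  simp [h0]

/-- If `dbar w = 0`, the connection is that of a unitary frame and the torsion vanishes. -/
theorem connection_eq (hg : IsUnitaryFrame V w g)
    (hϑ : ∀ x ∈ V, ∀ k v, ϑ k x v = ⟪g k x, fderiv ℝ z x v⟫)
    {φ : Fin m → Fin m → PHModel m → PHModel m →L[ℝ] ℂ} {A : Fin m → Fin m → PHModel m → ℂ}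
    (hφ : IsConnection V θ ϑ φ A) (hD : ∀ y ∈ V, ∀ v, θ y v = 0 → dbar J w y v = 0)
    {x : PHModel m} (hx : x ∈ V) :
    (∀ k j, φ k j x = frameConnection θ w g k j x) ∧ ∀ j k, A j k x = 0 := by
  obtain ⟨X, hXs, hX⟩ := H.exists_dual hg
  have h1 := IsConnection.congr H.isOpen (ϑ := ϑ)
    (fun x hx k => ContinuousLinearMap.ext (hϑ x hx k)) (H.isConnection hg hXs hX)
  obtain ⟨h2, h3⟩ := H.connection_unique hg hϑ hφ h1 hx
  refine ⟨h2, fun j k => ?_⟩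
  rw [h3, hD x hx _ (hX k x hx).1]
  simp

theorem torsion_eq_zero (hϑ : IsAdmissibleCoframe V θ J ϑ)
    {φ : Fin m → Fin m → PHModel m → PHModel m →L[ℝ] ℂ} {A : Fin m → Fin m → PHModel m → ℂ}
    (hφ : IsConnection V θ ϑ φ A) (hD : ∀ y ∈ V, ∀ v, θ y v = 0 → dbar J w y v = 0)
    {x : PHModel m} (hx : x ∈ V) (j k : Fin m) : A j k x = 0 := by
  obtain ⟨g, hg, hϑg⟩ := H.exists_unitaryFrame hϑ
  exact (H.connection_eq hg hϑg hφ hD hx).2 j k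

/-- The curvature tensor of a hypersurface with `dbar w = 0`. -/
theorem isCurvature (hg : IsUnitaryFrame V w g)
    (hϑ : ∀ x ∈ V, ∀ k v, ϑ k x v = ⟪g k x, fderiv ℝ z x v⟫)
    {φ : Fin m → Fin m → PHModel m → PHModel m →L[ℝ] ℂ} {A : Fin m → Fin m → PHModel m → ℂ}
    (hφ : IsConnection V θ ϑ φ A) (hD : ∀ y ∈ V, ∀ v, θ y v = 0 → dbar J w y v = 0) :
    IsCurvature V θ ϑ φ A fun k j p q x => ((‖w x‖ ^ 2 : ℝ) : ℂ) *
      ((if j = p then if k = q then 1 else 0 else 0)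
        + if j = k then if p = q then 1 else 0 else 0) := by
  intro x hx k j v u hv hu
  have hφe : ∀ k j, φ k j =ᶠ[𝓝 x] frameConnection θ w g k j := fun k j => by
    filter_upwards [H.eventually_mem hx] with y hy using (H.connection_eq hg hϑ hφ hD hy).1 k j
  have hA := (H.connection_eq hg hϑ hφ hD hx).2
  have hϑe : ∀ k, ϑ k x = innerForm (g k) z x := fun k => ContinuousLinearMap.ext (hϑ x hx k)
  have ht : ∀ j, torsionForm ϑ A j x = 0 := fun j => by
    ext v
    simp [torsionForm, hA]
  rw [dForm_eq_of_eventuallyEq (hφe k j)]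
  simp only [fun k j => (hφe k j).eq_of_nhds]
  rw [H.curvature_frame hg hx hD k j hv hu]
  simp only [ht, hϑe]
  have h0 : ∀ a : PHModel m →L[ℝ] ℂ, wedge a 0 v u = 0 := fun a => by simp [wedge]
  have h0' : ∀ a : PHModel m →L[ℝ] ℂ, wedge (conjForm 0) a v u = 0 := fun a => by
    simp [wedge, conjForm]
  rw [h0, h0', mul_zero, add_zero, sub_zero]
  simp only [mul_add, add_mul, Finset.sum_add_distrib]
  congr 1
  · simp
  · split_ifs
    · simp [Finset.mul_sum]
    · simp

/-- The coefficients are determined by the curvature identity: a form `∑ c_pq ϑᵖ ∧ ϑ^{q̄}` takes the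
values `c_ab - c_ba` on `(X_a, X_b)` and `i (c_ab + c_ba)` on `(J X_a, X_b)`. Hence `R` agrees with
the tensor of `isCurvature`, whose trace is `‖w‖² (m + m²)`. -/
theorem curvature_trace (hϑ : IsAdmissibleCoframe V θ J ϑ)
    {φ : Fin m → Fin m → PHModel m → PHModel m →L[ℝ] ℂ} {A : Fin m → Fin m → PHModel m → ℂ}
    (hφ : IsConnection V θ ϑ φ A) {R : Fin m → Fin m → Fin m → Fin m → PHModel m → ℂ}
    (hR : IsCurvature V θ ϑ φ A R) (hD : ∀ y ∈ V, ∀ v, θ y v = 0 → dbar J w y v = 0)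
    {x : PHModel m} (hx : x ∈ V) :
    ∑ k, ∑ l, R k k l l x = ((m * (m + 1) * ‖w x‖ ^ 2 : ℝ) : ℂ) := by
  obtain ⟨g, hg, hϑg⟩ := H.exists_unitaryFrame hϑ
  obtain ⟨X, -, hX⟩ := H.exists_dual hg
  have hϑX : ∀ k l, ϑ k x (X l x) = if k = l then 1 else 0 := fun k l => by
    rw [hϑg x hx, (hX l x hx).2, hg.inner_eq x hx]
  have hϑJ : ∀ k v, θ x v = 0 → ϑ k x (J x v) = Complex.I * ϑ k x v :=
    fun k v hv => hϑ.type_one_zero x hx k v hv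
  have hR0 := H.isCurvature hg hϑg hφ hD
  have hXX : ∀ (c : Fin m → Fin m → ℂ) a b, ∑ p, ∑ q,
      c p q * wedge (ϑ p x) (conjForm (ϑ q x)) (X a x) (X b x) = c a b - c b a := fun c a b => by
    simp [wedge, conjForm, hϑX, mul_sub, Finset.sum_sub_distrib]
  have hJX : ∀ (c : Fin m → Fin m → ℂ) a b, ∑ p, ∑ q,
      c p q * wedge (ϑ p x) (conjForm (ϑ q x)) (J x (X a x)) (X b x)
        = Complex.I * (c a b + c b a) := fun c a b => by
    simp [wedge, conjForm, hϑX, hϑJ _ _ (hX a x hx).1, mul_sub, Finset.sum_sub_distrib,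
      apply_ite (starRingEnd ℂ), Finset.sum_add_distrib]
    ring
  have key : ∀ k j p q, R k j p q x = ((‖w x‖ ^ 2 : ℝ) : ℂ) *
      ((if j = p then if k = q then 1 else 0 else 0)
        + if j = k then if p = q then 1 else 0 else 0) := by
    intro k j p q
    have hp := (hX p x hx).1
    have hq := (hX q x hx).1
    have h1 := (hR x hx k j (X p x) (X q x) hp hq).symm.trans (hR0 x hx k j _ _ hp hq)
    have h2 := (hR x hx k j (J x (X p x)) (X q x) (H.θ_J x hx _ hp) hq).symm.trans
      (hR0 x hx k j _ _ (H.θ_J x hx _ hp) hq)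
    rw [sub_left_inj, add_left_inj] at h1 h2
    rw [hXX, hXX] at h1
    rw [hJX, hJX] at h2
    have h3 := mul_left_cancel₀ Complex.I_ne_zero h2
    linear_combination (h1 + h3) / 2
  simp only [key]
  simp only [if_true, ← Finset.mul_sum, Finset.sum_add_distrib]
  simp
  ring

end IsContactHypersurface

/-! ### Pseudohermitian submanifolds in charts -/

section Charts

variable {m : ℕ} {M : Type*} [TopologicalSpace M] [ChartedSpace (PHModel m) M]
  {e : OpenPartialHomeomorph M (PHModel m)}

theorem contDiffOn_comp_symm {F : Type*} [NormedAddCommGroup F] [NormedSpace ℝ F] {h : M → F}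
    (he : e ∈ IsManifold.maximalAtlas 𝓘(ℝ, PHModel m) ∞ M)
    (hh : ContMDiff 𝓘(ℝ, PHModel m) 𝓘(ℝ, F) ∞ h) : ContDiffOn ℝ ∞ (h ∘ e.symm) e.target :=
  contMDiffOn_iff_contDiffOn.1 (hh.comp_contMDiffOn (contMDiffOn_symm_of_mem_maximalAtlas he))

theorem mdifferentiable_of_mem_maximalAtlas
    (he : e ∈ IsManifold.maximalAtlas 𝓘(ℝ, PHModel m) ∞ M) :
    e.MDifferentiable 𝓘(ℝ, PHModel m) 𝓘(ℝ, PHModel m) :=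
  ⟨(contMDiffOn_of_mem_maximalAtlas he).mdifferentiableOn (by simp),
    (contMDiffOn_symm_of_mem_maximalAtlas he).mdifferentiableOn (by simp)⟩

theorem mfderiv_symm_mfderiv (he : e ∈ IsManifold.maximalAtlas 𝓘(ℝ, PHModel m) ∞ M) {p : M}
    (hp : p ∈ e.source) (v : TangentSpace 𝓘(ℝ, PHModel m) p) :
    mfderiv 𝓘(ℝ, PHModel m) 𝓘(ℝ, PHModel m) e.symm (e p)
      (mfderiv 𝓘(ℝ, PHModel m) 𝓘(ℝ, PHModel m) e p v) = v :=
  congrArg (fun L : TangentSpace 𝓘(ℝ, PHModel m) p →L[ℝ] TangentSpace 𝓘(ℝ, PHModel m) p => L v)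
    ((mdifferentiable_of_mem_maximalAtlas he).symm_comp_deriv hp)

/-- The tangent vector of `M` with coordinates `v` in the chart `e`. -/
def chartLift (e : OpenPartialHomeomorph M (PHModel m)) (x v : PHModel m) :
    TangentSpace 𝓘(ℝ, PHModel m) (e.symm x) :=
  mfderiv 𝓘(ℝ, PHModel m) 𝓘(ℝ, PHModel m) e.symm x v

/-- The coordinates of a tangent vector of `M` in the chart `e`. -/
def chartCoord (e : OpenPartialHomeomorph M (PHModel m)) (p : M)
    (v : TangentSpace 𝓘(ℝ, PHModel m) p) : PHModel m :=
  mfderiv 𝓘(ℝ, PHModel m) 𝓘(ℝ, PHModel m) e p v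

theorem chartLift_chartCoord (he : e ∈ IsManifold.maximalAtlas 𝓘(ℝ, PHModel m) ∞ M)
    {x : PHModel m} (hx : x ∈ e.target) (v : TangentSpace 𝓘(ℝ, PHModel m) (e.symm x)) :
    chartLift e x (chartCoord e (e.symm x) v) = v := by
  have := mfderiv_symm_mfderiv he (e.map_target hx) v
  rw [e.right_inv hx] at this
  exact this

theorem chartCoord_chartLift (he : e ∈ IsManifold.maximalAtlas 𝓘(ℝ, PHModel m) ∞ M)
    {x : PHModel m} (hx : x ∈ e.target) (v : PHModel m) :
    chartCoord e (e.symm x) (chartLift e x v) = v :=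
  congrArg (fun L : PHModel m →L[ℝ] PHModel m => L v)
    ((mdifferentiable_of_mem_maximalAtlas he).comp_symm_deriv hx)

theorem fderiv_comp_symm {F : Type*} [NormedAddCommGroup F] [NormedSpace ℝ F] {h : M → F}
    (he : e ∈ IsManifold.maximalAtlas 𝓘(ℝ, PHModel m) ∞ M) {x : PHModel m} (hx : x ∈ e.target)
    (hh : MDifferentiableAt 𝓘(ℝ, PHModel m) 𝓘(ℝ, F) h (e.symm x)) (v : PHModel m) :
    fderiv ℝ (h ∘ e.symm) x v = mfderiv 𝓘(ℝ, PHModel m) 𝓘(ℝ, F) h (e.symm x)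
      (chartLift e x v) := by
  rw [← mfderiv_eq_fderiv, mfderiv_comp x hh
    ((mdifferentiable_of_mem_maximalAtlas he).mdifferentiableAt_symm hx)]
  rfl

theorem formInChart_apply (α : ∀ p : M, TangentSpace 𝓘(ℝ, PHModel m) p →L[ℝ] ℝ)
    (e : OpenPartialHomeomorph M (PHModel m)) (x v : PHModel m) :
    formInChart e α x v = α (e.symm x)
      (chartLift e x v) := rfl

theorem chartLift_endoInChart (he : e ∈ IsManifold.maximalAtlas 𝓘(ℝ, PHModel m) ∞ M)
    (J : ∀ p : M, TangentSpace 𝓘(ℝ, PHModel m) p →L[ℝ] TangentSpace 𝓘(ℝ, PHModel m) p)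
    {x : PHModel m} (hx : x ∈ e.target) (v : PHModel m) :
    chartLift e x (endoInChart e J x v)
      = J (e.symm x) (chartLift e x v) :=
  chartLift_chartCoord he hx (J (e.symm x) (chartLift e x v))

end Charts

section Submanifold

variable {m : ℕ} {M : Type*} [TopologicalSpace M] [ChartedSpace (PHModel m) M]
  [IsManifold 𝓘(ℝ, PHModel m) ∞ M] {S : PseudohermitianStructure m M} {f : M → Heis (m + 1)}
  (hf : IsPseudohermitianSubmanifold S f) {e : OpenPartialHomeomorph M (PHModel m)}
  (he : e ∈ IsManifold.maximalAtlas 𝓘(ℝ, PHModel m) ∞ M) {x : PHModel m} (hx : x ∈ e.target)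

/-- The `ℂⁿ`-component of a submanifold in a chart. -/
def zChart (e : OpenPartialHomeomorph M (PHModel m)) (f : M → Heis (m + 1)) (x : PHModel m) :
    EuclideanSpace ℂ (Fin (m + 1)) := (f (e.symm x)).1

/-- The `ℝ`-component of a submanifold in a chart. -/
def tChart (e : OpenPartialHomeomorph M (PHModel m)) (f : M → Heis (m + 1)) (x : PHModel m) : ℝ :=
  (f (e.symm x)).2

/-- The `ℂⁿ`-component of a vector field along `M` in a chart. -/
def vecChart (e : OpenPartialHomeomorph M (PHModel m)) (ν : M → Heis (m + 1)) (x : PHModel m) :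
    EuclideanSpace ℂ (Fin (m + 1)) := (ν (e.symm x)).1

include hf he

theorem contDiffOn_chart : ContDiffOn ℝ ∞ (f ∘ e.symm) e.target := contDiffOn_comp_symm he hf.smooth

theorem contDiffOn_zChart : ContDiffOn ℝ ∞ (zChart e f) e.target :=
  contDiff_fst.comp_contDiffOn (contDiffOn_chart hf he)

theorem contDiffOn_tChart : ContDiffOn ℝ ∞ (tChart e f) e.target :=
  contDiff_snd.comp_contDiffOn (contDiffOn_chart hf he)

include hx

theorem diffAt_chart (v : PHModel m) :
    diffAt f (e.symm x) (chartLift e x v)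
      = (fderiv ℝ (zChart e f) x v, fderiv ℝ (tChart e f) x v) := by
  have hd : DifferentiableAt ℝ (f ∘ e.symm) x :=
    ((contDiffOn_chart hf he).contDiffAt (e.open_target.mem_nhds hx)).differentiableAt (by simp)
  have h1 := fderiv_comp_symm he hx (hf.smooth.mdifferentiableAt (by simp)) v
  refine h1.symm.trans ?_
  have h2 : HasFDerivAt (zChart e f) ((ContinuousLinearMap.fst ℝ _ _).comp
    (fderiv ℝ (f ∘ e.symm) x)) x := hasFDerivAt_fst.comp x hd.hasFDerivAt
  have h3 : HasFDerivAt (tChart e f) ((ContinuousLinearMap.snd ℝ _ _).comp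
    (fderiv ℝ (f ∘ e.symm) x)) x := hasFDerivAt_snd.comp x hd.hasFDerivAt
  rw [h2.fderiv, h3.fderiv]
  rfl

theorem formInChart_eq (v : PHModel m) : formInChart e S.θ x v
    = fderiv ℝ (tChart e f) x v + (⟪zChart e f x, fderiv ℝ (zChart e f) x v⟫).im := by
  rw [formInChart_apply, hf.θ_eq, diffAt_chart hf he hx]
  rfl

/-- Differentiate `θ = dt + Im ⟪z, dz⟫`; the second derivatives of `t` and `z` are symmetric and
cancel. -/
theorem dForm_formInChart (u v : PHModel m) : dForm (formInChart e S.θ) x u v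
    = 2 * (⟪fderiv ℝ (zChart e f) x u, fderiv ℝ (zChart e f) x v⟫).im := by
  have hmem := e.open_target.mem_nhds hx
  have hθ : DifferentiableAt ℝ (formInChart e S.θ) x :=
    ((S.smooth_θ e he).contDiffAt hmem).differentiableAt (by simp)
  have hz := (contDiffOn_zChart hf he).contDiffAt hmem
  have ht := (contDiffOn_tChart hf he).contDiffAt hmem
  have hz2 : ContDiffAt ℝ 2 (zChart e f) x := hz.of_le two_le_infty
  have ht2 : ContDiffAt ℝ 2 (tChart e f) x := ht.of_le two_le_infty
  have hzd : DifferentiableAt ℝ (zChart e f) x := hz.differentiableAt (by simp)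
  have key : ∀ a b, fderiv ℝ (fun y => formInChart e S.θ y b) x a
      = fderiv ℝ (fderiv ℝ (tChart e f)) x a b
        + (fderiv ℝ (fun y => ⟪zChart e f y, fderiv ℝ (zChart e f) y b⟫) x a).im := by
    intro a b
    have h1 : (fun y => formInChart e S.θ y b) =ᶠ[𝓝 x] fun y => fderiv ℝ (tChart e f) y b
        + Complex.imCLM ⟪zChart e f y, fderiv ℝ (zChart e f) y b⟫ := by
      filter_upwards [hmem] with y hy using formInChart_eq hf he hy b
    have h2 : DifferentiableAt ℝ (fun y => ⟪zChart e f y, fderiv ℝ (zChart e f) y b⟫) x :=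
      hzd.inner ℂ (hz2.differentiableAt_fderiv.clm_apply (differentiableAt_const b))
    have h3 := Complex.imCLM.hasFDerivAt.comp x h2.hasFDerivAt
    have h4 : DifferentiableAt ℝ (fun y => fderiv ℝ (tChart e f) y b) x :=
      ht2.differentiableAt_fderiv.clm_apply (differentiableAt_const b)
    rw [h1.fderiv_eq, ← fderiv_form_apply ht2.differentiableAt_fderiv]
    exact congrArg (fun L : PHModel m →L[ℝ] ℝ => L a) (h4.hasFDerivAt.add h3).fderiv
  have h5 := congrArg Complex.im (fderiv_inner_fderiv_sub hzd hz2 u v)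
  rw [dForm, ← fderiv_form_apply hθ, ← fderiv_form_apply hθ, key, key, fderiv_fderiv_comm ht2 u v]
  rw [Complex.sub_im, Complex.sub_im, ← inner_conj_symm (fderiv ℝ (zChart e f) x v),
    Complex.conj_im] at h5
  linarith

omit hf in
theorem formInChart_J (v : PHModel m) : formInChart e S.θ x (endoInChart e S.J x v) = 0 := by
  rw [formInChart_apply, chartLift_endoInChart he S.J hx, S.θ_J]

theorem fderiv_zChart_J {v : PHModel m} (hv : formInChart e S.θ x v = 0) :
    fderiv ℝ (zChart e f) x (endoInChart e S.J x v)
      = Complex.I • fderiv ℝ (zChart e f) x v := by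
  have h1 := diffAt_chart hf he hx (endoInChart e S.J x v)
  rw [chartLift_endoInChart he S.J hx, hf.J_eq _ (chartLift e x v) hv, diffAt_chart hf he hx] at h1
  exact (Prod.ext_iff.1 h1).1.symm

omit hf in
theorem endoInChart_endoInChart {v : PHModel m} (hv : formInChart e S.θ x v = 0) :
    endoInChart e S.J x (endoInChart e S.J x v) = -v := by
  have h1 : chartLift e x (endoInChart e S.J x (endoInChart e S.J x v)) = -chartLift e x v := by
    rw [chartLift_endoInChart he S.J hx, chartLift_endoInChart he S.J hx]
    exact S.J_J _ _ hv
  have h2 := congrArg (chartCoord e (e.symm x)) h1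
  rw [chartCoord_chartLift he hx] at h2
  refine h2.trans ((map_neg (mfderiv 𝓘(ℝ, PHModel m) 𝓘(ℝ, PHModel m) e (e.symm x))
    (chartLift e x v)).trans ?_)
  exact congrArg Neg.neg (chartCoord_chartLift he hx v)

theorem fderiv_chart_injective {v : PHModel m} (h1 : fderiv ℝ (zChart e f) x v = 0)
    (h2 : formInChart e S.θ x v = 0) : v = 0 := by
  have h3 := formInChart_eq hf he hx v
  rw [h1, h2, inner_zero_right, Complex.zero_im, add_zero] at h3
  have h4 := diffAt_chart hf he hx v
  rw [h1, ← h3] at h4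
  have h5 : chartLift e x v = 0 :=
    hf.immersion _ (h4.trans (map_zero (diffAt f (e.symm x))).symm)
  rw [← chartCoord_chartLift he hx v, h5]
  exact map_zero (mfderiv 𝓘(ℝ, PHModel m) 𝓘(ℝ, PHModel m) e (e.symm x))

omit hx in
/-- A pseudohermitian submanifold of the Heisenberg group in a chart. -/
theorem exists_isContactHypersurface {ν : M → Heis (m + 1)} (hν : IsFundamentalVectorField S f ν)
    (hν0 : ∀ p, ν p ≠ 0) :
    ∃ ξ, IsContactHypersurface e.target (formInChart e S.θ) (endoInChart e S.J) (zChart e f)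
      (vecChart e ν) ξ := by
  have hw0 : ∀ p, (ν p).1 ≠ 0 := fun p h => hν0 p (by
    have h1 := (hν p).1
    rw [Heis.Θ, h, inner_zero_right, Complex.zero_im, add_zero] at h1
    exact Prod.ext h h1)
  choose u hu using fun p => (hν p).2.2
  set ξ : PHModel m → PHModel m := fun x =>
    chartCoord e (e.symm x) (u (e.symm x)) with hξ
  set w : PHModel m → EuclideanSpace ℂ (Fin (m + 1)) := vecChart e ν with hw
  have hAξ : ∀ x ∈ e.target, chartLift e x (ξ x)
      = u (e.symm x) := fun x hx => chartLift_chartCoord he hx _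
  have hzξ : ∀ x ∈ e.target, fderiv ℝ (zChart e f) x (ξ x) = w x := fun x hx => by
    have h1 := diffAt_chart hf he hx (ξ x)
    rw [hAξ x hx, hu] at h1
    have h2 := (Prod.ext_iff.1 h1).1
    simpa [Heis.T, hw, vecChart] using h2.symm
  have hθξ : ∀ x ∈ e.target, formInChart e S.θ x (ξ x) = 1 := fun x hx => by
    have h1 := (hν (e.symm x)).1
    rw [formInChart_apply, hAξ x hx, hf.θ_eq, hu]
    rw [Heis.Θ] at h1 ⊢
    rw [Heis.T, Prod.snd_add, Prod.fst_add, zero_add, add_assoc, h1, add_zero]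
  -- Real orthogonality to the `J`-invariant space `dz (ker θ)` implies complex orthogonality.
  have horth : ∀ x ∈ e.target, ∀ v, formInChart e S.θ x v = 0 →
      ⟪w x, fderiv ℝ (zChart e f) x v⟫ = 0 := by
    intro x hx v hv
    have hre : ∀ v, formInChart e S.θ x v = 0 →
        (⟪w x, fderiv ℝ (zChart e f) x v⟫).re = 0 := by
      intro v hv
      have h1 := (hν (e.symm x)).2.1 (chartLift e x v) hv
      rw [Heis.metric, (hν (e.symm x)).1, zero_mul, add_zero, diffAt_chart hf he hx] at h1
      exact h1
    have h1 := hre _ (formInChart_J he hx v)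
    rw [fderiv_zChart_J hf he hx hv, inner_smul_right] at h1
    apply Complex.ext
    · exact hre v hv
    · simpa using h1
  have hwdz : ∀ x ∈ e.target, ∀ v, ⟪w x, fderiv ℝ (zChart e f) x v⟫
      = ((‖w x‖ ^ 2 * formInChart e S.θ x v : ℝ) : ℂ) := by
    intro x hx v
    have h := horth x hx (v - formInChart e S.θ x v • ξ x) (by simp [hθξ x hx])
    rw [map_sub, map_smul, hzξ x hx, inner_sub_right, sub_eq_zero, ← Complex.coe_smul,
      inner_smul_right, inner_self_eq_ofReal] at h
    rw [h]; push_cast; ring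
  have hinj : ∀ x ∈ e.target, ∀ v, fderiv ℝ (zChart e f) x v = 0 → v = 0 := by
    intro x hx v hv
    have h1 := hwdz x hx v
    rw [hv, inner_zero_right] at h1
    have h2 : ‖w x‖ ^ 2 * formInChart e S.θ x v = 0 := by exact_mod_cast h1.symm
    have h3 : ‖w x‖ ^ 2 ≠ 0 := by simpa [hw, vecChart] using hw0 (e.symm x)
    exact fderiv_chart_injective hf he hx hv ((mul_eq_zero.1 h2).resolve_left h3)
  -- Both `ν` and the preimage `u` are given only pointwise. Smoothness of `ξ` follows because it is
  -- the unique solution of `K ξ = θ` for the smooth nondegenerate form `K = dθ + θ ⊗ θ`; then `w =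
  -- dz ξ` is smooth too.
  have hξs : ContDiffOn ℝ ∞ ξ e.target := by
    set K : PHModel m → PHModel m →L[ℝ] PHModel m →L[ℝ] ℝ := fun x =>
      fderiv ℝ (formInChart e S.θ) x - (fderiv ℝ (formInChart e S.θ) x).flip
        + (formInChart e S.θ x).smulRight (formInChart e S.θ x) with hK
    have hKapp : ∀ x a b, K x a b = dForm (formInChart e S.θ) x a b
        + formInChart e S.θ x a * formInChart e S.θ x b := fun x a b => rfl
    have hθs := S.smooth_θ e he
    have hKs : ContDiffOn ℝ ∞ K e.target := by
      rw [contDiffOn_clm_apply]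
      intro a
      rw [contDiffOn_clm_apply]
      intro b
      simp only [hKapp, dForm]
      have h1 := contDiffOn_fderiv_infty e.open_target hθs
      have h2 : ∀ c, ContDiffOn ℝ ∞ (fun x => formInChart e S.θ x c) e.target := fun c =>
        hθs.clm_apply contDiffOn_const
      exact (((h1.clm_apply contDiffOn_const).clm_apply contDiffOn_const).sub
        ((h1.clm_apply contDiffOn_const).clm_apply contDiffOn_const)).add ((h2 a).mul (h2 b))
    have hKinj : ∀ x ∈ e.target, ∀ v, K x v = 0 → v = 0 := by
      intro x hx v hv
      have h1 := congrArg (fun L : PHModel m →L[ℝ] ℝ => L (ξ x)) hv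
      -- Nondegeneracy: testing `K v` on `ξ` gives `θ v = 0`, then testing on `J v` gives `2 ‖dz v‖²
      -- = 0`.
      have h2 := congrArg (fun L : PHModel m →L[ℝ] ℝ => L (endoInChart e S.J x v)) hv
      simp only [hKapp, dForm_formInChart hf he hx, hθξ x hx, hzξ x hx, zero_apply] at h1 h2
      rw [← inner_conj_symm, hwdz x hx, Complex.conj_ofReal, Complex.ofReal_im, mul_zero, zero_add,
        mul_one] at h1
      rw [fderiv_zChart_J hf he hx h1, inner_smul_right, inner_self_eq_ofReal, h1, zero_mul,
        add_zero] at h2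
      apply hinj x hx
      rw [Complex.I_mul_im, Complex.ofReal_re] at h2
      exact norm_eq_zero.1 (pow_eq_zero_iff (two_ne_zero)|>.1 (by linarith))
    have hdim : Module.finrank ℝ (PHModel m) = Module.finrank ℝ (PHModel m →L[ℝ] ℝ) :=
      (InnerProductSpace.toDual ℝ (PHModel m)).toLinearEquiv.finrank_eq
    obtain ⟨X, hX, hKX⟩ := exists_contDiffOn_solution e.open_target hKs hθs hdim hKinj
    refine hX.congr fun x hx => ?_
    have h1 : K x (ξ x) = formInChart e S.θ x := by
      ext v
      rw [hKapp, dForm_formInChart hf he hx, hzξ x hx, hθξ x hx, hwdz x hx, Complex.ofReal_im]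
      ring
    exact sub_eq_zero.1 (hKinj x hx _ (by rw [map_sub, h1, hKX x hx, sub_self]))
  have hws : ContDiffOn ℝ ∞ w e.target :=
    ((contDiffOn_fderiv_infty e.open_target (contDiffOn_zChart hf he)).clm_apply hξs).congr
      fun x hx => (hzξ x hx).symm
  exact ⟨ξ, {
    isOpen := e.open_target
    smooth_z := contDiffOn_zChart hf he
    smooth_w := hws
    smooth_θ := S.smooth_θ e he
    smooth_ξ := hξs
    smooth_J := S.smooth_J e he
    dθ := fun x hx => dForm_formInChart hf he hx
    θ_ξ := hθξ
    z_ξ := hzξ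
    θ_J := fun x hx v _ => formInChart_J he hx v
    z_J := fun x hx v hv => fderiv_zChart_J hf he hx hv
    J_J := fun x hx v hv => endoInChart_endoInChart he hx hv
    orth := horth
    w_ne := fun x _ => hw0 _
    inj := hinj
    surj := fun x hx h hh => exists_eq_of_inner_eq_zero (hw0 _) (hwdz x hx) (hinj x hx)
      (by simp; ring) hh }⟩

end Submanifold

/-! ### Torsion and second fundamental form -/

section Submanifold

variable {m : ℕ} {M : Type*} [TopologicalSpace M] [ChartedSpace (PHModel m) M]
  [IsManifold 𝓘(ℝ, PHModel m) ∞ M] {S : PseudohermitianStructure m M} {f : M → Heis (m + 1)}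
  {ν : M → Heis (m + 1)}

/-- The fundamental vector field is a CR function on `M`. -/
def IsCRFundamentalField (S : PseudohermitianStructure m M) (ν : M → Heis (m + 1)) : Prop :=
  ∀ e ∈ IsManifold.maximalAtlas 𝓘(ℝ, PHModel m) ∞ M, ∀ x ∈ e.target, ∀ v,
    formInChart e S.θ x v = 0 → dbar (endoInChart e S.J) (vecChart e ν) x v = 0

/-- The torsion coefficients are half the components of `dbar w` in a unitary frame. Local frames
supply a coframe to test on in one direction; in the other, every admissible coframe comes from a
frame. -/
theorem torsionVanishes_iff (hf : IsPseudohermitianSubmanifold S f)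
    (hν : IsFundamentalVectorField S f ν) (hν0 : ∀ p, ν p ≠ 0) :
    TorsionVanishes S ↔ IsCRFundamentalField S ν := by
  constructor
  · intro hT e he x hx
    obtain ⟨ξ, H⟩ := exists_isContactHypersurface hf he hν hν0
    obtain ⟨V, hVe, hV, hxV, g, hg⟩ := H.exists_local_frame hx
    exact (H.mono hV hVe).dbar_eq_zero_of_torsion hg (hT e he V hV hVe) x hxV
  · intro hD e he V hV hVe ϑ φ A hϑ hφ x hx j k
    obtain ⟨ξ, H⟩ := exists_isContactHypersurface hf he hν hν0
    exact (H.mono hV hVe).torsion_eq_zero hϑ hφ (fun y hy => hD e he y (hVe hy)) hx j k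

variable {e : OpenPartialHomeomorph M (PHModel m)}
  (he : e ∈ IsManifold.maximalAtlas 𝓘(ℝ, PHModel m) ∞ M) {x : PHModel m} (hx : x ∈ e.target)

include he hx

theorem holTangent_eq (hf : IsPseudohermitianSubmanifold S f)
    (hν : IsFundamentalVectorField S f ν) (hν0 : ∀ p, ν p ≠ 0) :
    holTangent S f (e.symm x) = (Submodule.span ℂ {vecChart e ν x})ᗮ := by
  obtain ⟨ξ, H⟩ := exists_isContactHypersurface hf he hν hν0
  apply le_antisymm
  · refine Submodule.span_le.2 ?_
    rintro _ ⟨v, hv, rfl⟩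
    rw [SetLike.mem_coe, Submodule.mem_orthogonal_singleton_iff_inner_right]
    rw [← chartLift_chartCoord he hx v] at hv ⊢
    rw [diffAt_chart hf he hx]
    exact H.orth x hx _ hv
  · intro h hh
    rw [Submodule.mem_orthogonal_singleton_iff_inner_right] at hh
    obtain ⟨v, hv, rfl⟩ := H.surj x hx h hh
    exact Submodule.subset_span ⟨chartLift e x v, hv, by rw [diffAt_chart hf he hx]⟩

/-- Differentiating `⟪w, W⟫ = 0` transfers the derivative from `W` to `w`. Conjugate linearity in
the first slot turns the (1,0)-derivative of `W` into the (0,1)-derivative of `w`; the normal space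
is spanned by `w`. -/
theorem secondFundamentalForm_eq_zero_iff (hf : IsPseudohermitianSubmanifold S f)
    (hν : IsFundamentalVectorField S f ν) (hν0 : ∀ p, ν p ≠ 0)
    {W : M → EuclideanSpace ℂ (Fin (m + 1))}
    (hW : MDifferentiableAt 𝓘(ℝ, PHModel m) 𝓘(ℝ, EuclideanSpace ℂ (Fin (m + 1))) W (e.symm x))
    (hWt : ∀ᶠ y in 𝓝 x, W (e.symm y) ∈ holTangent S f (e.symm y)) (v : PHModel m) :
    secondFundamentalForm S f (e.symm x) (chartLift e x v) W = 0
      ↔ ⟪dbar (endoInChart e S.J) (vecChart e ν) x v, W (e.symm x)⟫ = 0 := by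
  obtain ⟨ξ, H⟩ := exists_isContactHypersurface hf he hν hν0
  have hWx : DifferentiableAt ℝ (W ∘ e.symm) x :=
    (hW.comp x ((mdifferentiable_of_mem_maximalAtlas he).mdifferentiableAt_symm hx)).differentiableAt
  have hWe : ∀ᶠ y in 𝓝 x, ⟪vecChart e ν y, (W ∘ e.symm) y⟫ = 0 := by
    filter_upwards [hWt, e.open_target.mem_nhds hx] with y hy hye
    rw [holTangent_eq he hye hf hν hν0] at hy
    exact Submodule.mem_orthogonal_singleton_iff_inner_right.1 hy
  have hderiv := inner_fderiv_of_const (H.differentiableAt hx H.smooth_w) hWx hWe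
  have h1 : mfderiv 𝓘(ℝ, PHModel m) 𝓘(ℝ, EuclideanSpace ℂ (Fin (m + 1))) W (e.symm x)
      (chartLift e x v) = fderiv ℝ (W ∘ e.symm) x v := (fderiv_comp_symm he hx hW v).symm
  have h2 : mfderiv 𝓘(ℝ, PHModel m) 𝓘(ℝ, EuclideanSpace ℂ (Fin (m + 1))) W (e.symm x)
      (S.J (e.symm x) (chartLift e x v))
      = fderiv ℝ (W ∘ e.symm) x (endoInChart e S.J x v) := by
    rw [← chartLift_endoInChart he S.J hx]
    exact (fderiv_comp_symm he hx hW _).symm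
  have h3 : ⟪dbar (endoInChart e S.J) (vecChart e ν) x v, W (e.symm x)⟫
      = -⟪vecChart e ν x, fderiv ℝ (W ∘ e.symm) x v
        - Complex.I • fderiv ℝ (W ∘ e.symm) x (endoInChart e S.J x v)⟫ := by
    have h4 := hderiv v
    have h5 := hderiv (endoInChart e S.J x v)
    rw [dbar, inner_add_left, inner_smul_left, inner_sub_right, inner_smul_right, Complex.conj_I]
    simp only [Function.comp_apply] at h4 h5
    linear_combination h4 - Complex.I * h5
  have h6 : secondFundamentalForm S f (e.symm x) (chartLift e x v) W
      = (holTangent S f (e.symm x))ᗮ.starProjection ((1 / 2 : ℂ) •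
        (fderiv ℝ (W ∘ e.symm) x v
          - Complex.I • fderiv ℝ (W ∘ e.symm) x (endoInChart e S.J x v))) := by
    rw [← h1, ← h2]; rfl
  rw [h6, h3, Submodule.starProjection_apply_eq_zero_iff, Submodule.orthogonal_orthogonal,
    holTangent_eq he hx hf hν hν0, Submodule.mem_orthogonal_singleton_iff_inner_right,
    inner_smul_right, neg_eq_zero, mul_eq_zero]
  exact or_iff_right (by norm_num)

omit he hx in
theorem secondFundamentalFormVanishes_iff (hf : IsPseudohermitianSubmanifold S f)
    (hν : IsFundamentalVectorField S f ν) (hν0 : ∀ p, ν p ≠ 0) :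
    SecondFundamentalFormVanishes S f ↔ IsCRFundamentalField S ν := by
  constructor
  · intro hII e he x hx v hv
    obtain ⟨ξ, H⟩ := exists_isContactHypersurface hf he hν hν0
    set h := dbar (endoInChart e S.J) (vecChart e ν) x v with hh
    have hwh : ⟪vecChart e ν x, h⟫ = 0 := H.inner_w_dbar hx hv
    -- The value `h = dbar w v` is itself holomorphically tangent. Extending it to a tangent section
    -- and testing `II` on that section gives `⟪h, h⟫ = 0`.
    set G : PHModel m → EuclideanSpace ℂ (Fin (m + 1)) := fun y =>
      h - (⟪vecChart e ν y, h⟫ / ((‖vecChart e ν y‖ ^ 2 : ℝ) : ℂ)) • vecChart e ν y with hG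
    have hρ : ∀ y ∈ e.target, ((‖vecChart e ν y‖ ^ 2 : ℝ) : ℂ) ≠ 0 := fun y hy => by
      exact_mod_cast (H.norm_w_pos hy).ne'
    have hc : ContDiffOn ℝ ∞
        (fun y => ⟪vecChart e ν y, h⟫ / ((‖vecChart e ν y‖ ^ 2 : ℝ) : ℂ)) e.target := by
      simp only [div_eq_mul_inv]
      exact (H.smooth_w.inner ℂ contDiffOn_const).mul
        ((Complex.ofRealCLM.contDiff.comp_contDiffOn (H.smooth_w.norm_sq ℂ)).inv hρ)
    have hGs : ContDiffOn ℝ ∞ G e.target := contDiffOn_const.sub (hc.smul H.smooth_w)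
    have hGt : ∀ y ∈ e.target, ⟪vecChart e ν y, G y⟫ = 0 := by
      intro y hy
      have := hρ y hy
      simp only [hG, inner_sub_right, inner_smul_right, inner_self_eq_ofReal]
      field_simp; ring
    have hGx : G x = h := by simp [hG, hwh]
    have hWs : ContMDiffOn 𝓘(ℝ, PHModel m) 𝓘(ℝ, EuclideanSpace ℂ (Fin (m + 1))) ∞ (G ∘ e)
        e.source := (contMDiffOn_iff_contDiffOn.2 hGs).comp (contMDiffOn_of_mem_maximalAtlas he)
          fun p hp => e.map_source hp
    have hWt : ∀ q ∈ e.source, (G ∘ e) q ∈ holTangent S f q := by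
      intro q hq
      have h1 := holTangent_eq he (e.map_source hq) hf hν hν0
      rw [e.left_inv hq] at h1
      rw [h1, Submodule.mem_orthogonal_singleton_iff_inner_right]
      exact hGt _ (e.map_source hq)
    have h2 := hII e.source (G ∘ e) e.open_source hWs hWt (e.symm x) (e.map_target hx)
      (chartLift e x v) hv
    rw [secondFundamentalForm_eq_zero_iff he hx hf hν hν0] at h2
    · rw [Function.comp_apply, e.right_inv hx, hGx] at h2
      exact inner_self_eq_zero.1 h2
    · exact ((hWs.contMDiffAt (e.open_source.mem_nhds (e.map_target hx))).mdifferentiableAt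
        (by simp))
    · filter_upwards [e.open_target.mem_nhds hx] with y hy using hWt _ (e.map_target hy)
  · intro hD U W hU hW hWt p hp v hv
    obtain ⟨e, he, hps⟩ : ∃ e ∈ IsManifold.maximalAtlas 𝓘(ℝ, PHModel m) ∞ M, p ∈ e.source :=
      ⟨_, IsManifold.chart_mem_maximalAtlas p, mem_chart_source _ p⟩
    obtain ⟨x, hx, rfl⟩ : ∃ x ∈ e.target, e.symm x = p :=
      ⟨e p, e.map_source hps, e.left_inv hps⟩
    rw [← chartLift_chartCoord he hx v] at hv ⊢
    rw [secondFundamentalForm_eq_zero_iff he hx hf hν hν0, hD e he x hx _ hv, inner_zero_left]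
    · exact (hW.contMDiffAt (hU.mem_nhds hp)).mdifferentiableAt (by simp)
    · filter_upwards [(e.continuousAt_symm hx).preimage_mem_nhds (hU.mem_nhds hp)] with y hy
        using hWt _ hy

end Submanifold

/-! ### The image in the sphere -/

section Rigidity

variable {m : ℕ} {M : Type*} [TopologicalSpace M] [ChartedSpace (PHModel m) M]

theorem eq_of_fderiv_comp_symm_eq_zero [IsManifold 𝓘(ℝ, PHModel m) ∞ M] [PreconnectedSpace M]
    {F : Type*} [NormedAddCommGroup F]
    [NormedSpace ℝ F] {φ : M → F}
    (h : ∀ e ∈ IsManifold.maximalAtlas 𝓘(ℝ, PHModel m) ∞ M,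
      ContDiffOn ℝ ∞ (φ ∘ e.symm) e.target ∧ ∀ x ∈ e.target, fderiv ℝ (φ ∘ e.symm) x = 0)
    (p q : M) : φ p = φ q := by
  refine IsLocallyConstant.apply_eq_of_preconnectedSpace ?_ p q
  rw [IsLocallyConstant.iff_eventually_eq]
  intro p
  obtain ⟨e, he, hps⟩ : ∃ e ∈ IsManifold.maximalAtlas 𝓘(ℝ, PHModel m) ∞ M, p ∈ e.source :=
      ⟨_, IsManifold.chart_mem_maximalAtlas p, mem_chart_source _ p⟩
  obtain ⟨hs, h0⟩ := h e he
  obtain ⟨ε, hε, hball⟩ := Metric.isOpen_iff.1 e.open_target (e p) (e.map_source hps)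
  filter_upwards [(e.continuousAt hps).preimage_mem_nhds (Metric.ball_mem_nhds (e p) hε),
    e.open_source.mem_nhds hps] with q hq hqs
  have h1 := Metric.isOpen_ball.is_const_of_fderiv_eq_zero (𝕜 := ℝ)
    (convex_ball (e p) ε).isPreconnected ((hs.mono hball).differentiableOn (by simp))
    (fun y hy => h0 y (hball hy)) hq (Metric.mem_ball_self hε)
  simpa [e.left_inv hqs, e.left_inv hps] using h1

variable [IsManifold 𝓘(ℝ, PHModel m) ∞ M] {S : PseudohermitianStructure m M}
  {f : M → Heis (m + 1)} {ν : M → Heis (m + 1)} (hf : IsPseudohermitianSubmanifold S f)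
  (hν : IsFundamentalVectorField S f ν) (hν0 : ∀ p, ν p ≠ 0)

include hf hν hν0

omit hf hν0 in
theorem length_eq (p : M) : Heis.length (f p) (ν p) = ‖(ν p).1‖ := by
  rw [Heis.length, Heis.metric, (hν p).1, zero_mul, add_zero, inner_self_eq_ofReal,
    Complex.ofReal_re, Real.sqrt_sq (norm_nonneg _)]

/-- A submanifold whose fundamental vector field is CR lies in a sphere. -/
theorem exists_center (hm : 1 ≤ m) [PreconnectedSpace M] [Nonempty M]
    (hD : IsCRFundamentalField S ν) : ∃ c : ℝ, 0 < c ∧ (∀ p, ‖(ν p).1‖ = c) ∧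
      ∃ (z₀ : EuclideanSpace ℂ (Fin (m + 1))) (τ : ℝ),
        (∀ p, (ν p).1 = (Complex.I * (c ^ 2 : ℝ)) • ((f p).1 - z₀)) ∧
        ∀ p, (f p).2 + (⟪z₀, (f p).1⟫).im = τ := by
  -- This is where `1 ≤ m` enters: the contact distribution is nonzero.
  have hne : ∀ e ∈ IsManifold.maximalAtlas 𝓘(ℝ, PHModel m) ∞ M, ∀ x ∈ e.target,
      ∃ v, formInChart e S.θ x v = 0 ∧ v ≠ 0 := by
    intro e he x hx
    obtain ⟨ξ, H⟩ := exists_isContactHypersurface hf he hν hν0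
    have : Fact (Module.finrank ℂ (EuclideanSpace ℂ (Fin (m + 1))) = m + 1) := ⟨by simp⟩
    let B := OrthonormalBasis.fromOrthogonalSpanSingleton (𝕜 := ℂ) m (H.w_ne x hx)
    obtain ⟨v, hv, hvB⟩ := H.surj x hx (B ⟨0, hm⟩ : EuclideanSpace ℂ (Fin (m + 1)))
      (Submodule.mem_orthogonal_singleton_iff_inner_right.1 (B ⟨0, hm⟩).2)
    refine ⟨v, hv, fun h => ?_⟩
    rw [h, map_zero] at hvB
    exact B.orthonormal.ne_zero ⟨0, hm⟩ (Subtype.ext hvB.symm)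
  have hnorm : ∀ p q, ‖(ν p).1‖ ^ 2 = ‖(ν q).1‖ ^ 2 := by
    refine eq_of_fderiv_comp_symm_eq_zero (m := m) fun e he => ?_
    obtain ⟨ξ, H⟩ := exists_isContactHypersurface hf he hν hν0
    refine ⟨H.smooth_w.norm_sq ℂ, fun x hx => ?_⟩
    obtain ⟨v, hv, hv0⟩ := hne e he x hx
    exact H.fderiv_norm_sq_eq_zero hx (hD e he) hv hv0
  obtain ⟨p₀⟩ := ‹Nonempty M›
  obtain ⟨c, hc⟩ : ∃ c, c = ‖(ν p₀).1‖ := ⟨_, rfl⟩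
  have hνc : ∀ p, ‖(ν p).1‖ = c := fun p => by
    rw [hc]; exact (sq_eq_sq₀ (norm_nonneg _) (norm_nonneg _)).1 (hnorm p p₀)
  have hcpos : 0 < c := by
    obtain ⟨e, he, hps⟩ : ∃ e ∈ IsManifold.maximalAtlas 𝓘(ℝ, PHModel m) ∞ M, p₀ ∈ e.source :=
      ⟨_, IsManifold.chart_mem_maximalAtlas p₀, mem_chart_source _ p₀⟩
    obtain ⟨ξ, H⟩ := exists_isContactHypersurface hf he hν hν0
    have := norm_pos_iff.2 (H.w_ne _ (e.map_source hps))
    rwa [vecChart, hνc] at this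
  have hc0 : Complex.I * ((c ^ 2 : ℝ) : ℂ) ≠ 0 :=
    mul_ne_zero Complex.I_ne_zero (by exact_mod_cast (pow_pos hcpos 2).ne')
  have hconst : ∀ p q, (ν p).1 - (Complex.I * ((c ^ 2 : ℝ) : ℂ)) • (f p).1
      = (ν q).1 - (Complex.I * ((c ^ 2 : ℝ) : ℂ)) • (f q).1 := by
    refine eq_of_fderiv_comp_symm_eq_zero (m := m) fun e he => ?_
    obtain ⟨ξ, H⟩ := exists_isContactHypersurface hf he hν hν0
    have h1 : ((fun p => (ν p).1 - (Complex.I * ((c ^ 2 : ℝ) : ℂ)) • (f p).1) ∘ e.symm)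
        = fun y => vecChart e ν y - (Complex.I * ((c ^ 2 : ℝ) : ℂ)) • zChart e f y := rfl
    rw [h1]
    refine ⟨H.smooth_w.sub (H.smooth_z.const_smul _), fun x hx => ?_⟩
    rw [← H.fderiv_sub_eq_zero hx (hD e he) (hne e he)]
    congr 1
    funext y
    rw [vecChart, hνc]
  -- The centre solves `w - i c² z = -i c² z₀`, the left side being constant.
  refine ⟨c, hcpos, hνc, -(Complex.I * ((c ^ 2 : ℝ) : ℂ))⁻¹ •
    ((ν p₀).1 - (Complex.I * ((c ^ 2 : ℝ) : ℂ)) • (f p₀).1), ?_⟩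
  set z₀ := -(Complex.I * ((c ^ 2 : ℝ) : ℂ))⁻¹ •
    ((ν p₀).1 - (Complex.I * ((c ^ 2 : ℝ) : ℂ)) • (f p₀).1) with hz₀
  have hνz : ∀ p, (ν p).1 = (Complex.I * ((c ^ 2 : ℝ) : ℂ)) • ((f p).1 - z₀) := by
    intro p
    rw [hz₀, smul_sub, smul_smul, mul_neg, mul_inv_cancel₀ hc0, ← hconst p p₀, neg_smul, one_smul]
    abel
  -- Inserting `w = i c² (z - z₀)` into `⟪w, dz⟫ = c² θ` gives `θ = Im ⟪z - z₀, dz⟫`. Comparison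
  -- with `θ = dt + Im ⟪z, dz⟫` leaves `dt + Im ⟪z₀, dz⟫ = 0`.
  have hτ : ∀ p q, (f p).2 + (⟪z₀, (f p).1⟫).im = (f q).2 + (⟪z₀, (f q).1⟫).im := by
    refine eq_of_fderiv_comp_symm_eq_zero (m := m) fun e he => ?_
    obtain ⟨ξ, H⟩ := exists_isContactHypersurface hf he hν hν0
    have h1 : ((fun p => (f p).2 + (⟪z₀, (f p).1⟫).im) ∘ e.symm)
        = fun y => tChart e f y + Complex.imCLM ⟪z₀, zChart e f y⟫ := rfl
    rw [h1]
    have ht := contDiffOn_tChart hf he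
    have hz0 : ContDiffOn ℝ ∞ (fun y => ⟪z₀, zChart e f y⟫) e.target :=
      contDiffOn_const.inner ℂ H.smooth_z
    refine ⟨ht.add (Complex.imCLM.contDiff.comp_contDiffOn hz0), fun x hx => ?_⟩
    have h2 := (H.differentiableAt hx ht).hasFDerivAt.add
      (Complex.imCLM.hasFDerivAt.comp x (H.differentiableAt hx hz0).hasFDerivAt)
    refine h2.fderiv.trans ?_
    ext v
    have h3 := formInChart_eq hf he hx v
    have h4 := H.inner_w_dz hx v
    have h5 : ‖vecChart e ν x‖ = c := hνc _
    have h6 : vecChart e ν x = (Complex.I * ((c ^ 2 : ℝ) : ℂ)) • (zChart e f x - z₀) := hνz _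
    have hcc : ((c ^ 2 : ℝ) : ℂ) ≠ 0 := by exact_mod_cast (pow_pos hcpos 2).ne'
    rw [h5, h6, inner_smul_left, inner_sub_left, map_mul, Complex.conj_I, Complex.conj_ofReal,
      Complex.ofReal_mul, neg_mul, neg_mul, mul_comm Complex.I, mul_assoc, ← mul_neg] at h4
    have h7 := congrArg Complex.re (mul_left_cancel₀ hcc h4)
    simp at h7
    have h8 : fderiv ℝ (fun y => ⟪z₀, zChart e f y⟫) x v = ⟪z₀, fderiv ℝ (zChart e f) x v⟫ := by
      rw [fderiv_inner_apply ℂ (differentiableAt_const z₀) (H.differentiableAt hx H.smooth_z)]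
      simp
    simp only [add_apply, ContinuousLinearMap.comp_apply, h8, Complex.imCLM_apply, zero_apply]
    linarith
  exact ⟨_, hνz, fun p => hτ p p₀⟩

/-- A submanifold which lies in a sphere is locally homeomorphic to it. -/
theorem isLocalHomeomorph_sphere {r : ℝ} {z₀ : EuclideanSpace ℂ (Fin (m + 1))}
    {κ : ℝ} (hκ : κ ≠ 0) (hz : ∀ p, (f p).1 - z₀ = κ • (Complex.I • (ν p).1)) (hr : 0 < r)
    {F : M → Heis.sphere (m + 1) r} (hF : ∀ p, (F p : Heis (m + 1)) = ((f p).1 - z₀, 0)) :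
    IsLocalHomeomorph F := by
  have hnorm : ∀ p, ‖(f p).1 - z₀‖ = r := fun p => by
    have := (F p).2.1
    rwa [hF] at this
  have hcont : Continuous F := by
    refine Continuous.subtype_mk (f := fun p => (F p : Heis (m + 1))) ?_ _
    simp only [hF]
    exact ((continuous_fst.comp hf.smooth.continuous).sub continuous_const).prodMk continuous_const
  -- To avoid charts on the sphere, the hypersurface is thickened radially: `(y, s) ↦ eˢ (z - z₀)`
  -- is a local diffeomorphism into `ℂⁿ`, because the radial direction is a multiple of `i w`, which
  -- is transversal to the image of `dz`.
  have hloc : ∀ p : M, ∃ (e : OpenPartialHomeomorph M (PHModel m)) (G : OpenPartialHomeomorph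
      (PHModel m × ℝ) (EuclideanSpace ℂ (Fin (m + 1)))), p ∈ e.source ∧ (e p, 0) ∈ G.source ∧
      ∀ y s, G (y, s) = Real.exp s • ((f (e.symm y)).1 - z₀) := by
    intro p
    obtain ⟨e, he, hps⟩ : ∃ e ∈ IsManifold.maximalAtlas 𝓘(ℝ, PHModel m) ∞ M, p ∈ e.source :=
      ⟨_, IsManifold.chart_mem_maximalAtlas p, mem_chart_source _ p⟩
    obtain ⟨ξ, H⟩ := exists_isContactHypersurface hf he hν hν0
    have hx := e.map_source hps
    set g : PHModel m × ℝ → EuclideanSpace ℂ (Fin (m + 1)) := fun y =>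
      Real.exp y.2 • (zChart e f y.1 - z₀) with hg
    have hzs : ContDiffAt ℝ ∞ (zChart e f) (e p) :=
      H.smooth_z.contDiffAt (e.open_target.mem_nhds hx)
    have hgs : ContDiffAt ℝ ∞ g (e p, 0) :=
      (Real.contDiff_exp.contDiffAt.comp _ contDiffAt_snd).smul
        ((hzs.comp (e p, (0 : ℝ)) contDiffAt_fst).sub contDiffAt_const)
    have hstrict := hgs.hasStrictFDerivAt (by simp)
    have hderiv : ∀ v s, fderiv ℝ g (e p, 0) (v, s)
        = fderiv ℝ (zChart e f) (e p) v + (s * κ) • (Complex.I • vecChart e ν (e p)) := by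
      intro v s
      have h1 : HasFDerivAt (fun y : PHModel m × ℝ => Real.exp y.2)
          (Real.exp 0 • ContinuousLinearMap.snd ℝ (PHModel m) ℝ) (e p, 0) :=
        (hasFDerivAt_snd (𝕜 := ℝ) (p := (e p, (0 : ℝ)))).exp
      have h2 : HasFDerivAt (fun y : PHModel m × ℝ => zChart e f y.1 - z₀)
          ((fderiv ℝ (zChart e f) (e p)).comp (ContinuousLinearMap.fst ℝ (PHModel m) ℝ))
          (e p, 0) :=
        (HasFDerivAt.comp (f := Prod.fst) (g := zChart e f) (e p, (0 : ℝ))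
          (hzs.differentiableAt (by simp)).hasFDerivAt hasFDerivAt_fst).sub_const z₀
      have h3 : zChart e f (e p) - z₀ = κ • (Complex.I • vecChart e ν (e p)) := hz _
      have h4 : fderiv ℝ g (e p, 0) = _ := (h1.smul h2).fderiv
      rw [h4]
      simp [h3, smul_smul]
    have hinj : Function.Injective
        (fderiv ℝ g (e p, 0) : PHModel m × ℝ →ₗ[ℝ] EuclideanSpace ℂ (Fin (m + 1))) := by
      refine (injective_iff_map_eq_zero _).2 ?_
      rintro ⟨v, s⟩ h0
      replace h0 : fderiv ℝ g (e p, 0) (v, s) = 0 := h0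
      rw [hderiv] at h0
      obtain ⟨-, hs⟩ := eq_zero_of_add_smul (H.w_ne _ hx) (H.inner_w_dz hx) (inner_zero_right _) h0
      rw [hs, zero_smul, add_zero] at h0
      rw [H.inj _ hx v h0, (mul_eq_zero.1 hs).resolve_right hκ]; rfl
    have hdim : Module.finrank ℝ (PHModel m × ℝ)
        = Module.finrank ℝ (EuclideanSpace ℂ (Fin (m + 1))) := by
      rw [finrank_real_euclideanSpace_complex]
      simp; ring
    let L := (LinearEquiv.ofInjectiveOfFinrankEq _ hinj hdim).toContinuousLinearEquiv
    have hL : (L : (PHModel m × ℝ) →L[ℝ] _) = fderiv ℝ g (e p, 0) :=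
      ContinuousLinearMap.ext fun v => rfl
    have hstrict' : HasStrictFDerivAt g (L : (PHModel m × ℝ) →L[ℝ] _) (e p, 0) := hL ▸ hstrict
    exact ⟨e, hstrict'.toOpenPartialHomeomorph g, hps,
      hstrict'.mem_toOpenPartialHomeomorph_source, fun y s => rfl⟩
  have hopen : IsOpenMap F := by
    refine IsOpenMap.of_nhds_le fun p N hN => ?_
    obtain ⟨e, G, hpe, hpG, hG⟩ := hloc p
    have hQ : {y : PHModel m × ℝ | e.symm y.1 ∈ F ⁻¹' N} ∈ 𝓝 (e p, (0 : ℝ)) := by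
      have h1 : ContinuousAt (fun y : PHModel m × ℝ => e.symm y.1) (e p, 0) :=
        ContinuousAt.comp (f := Prod.fst) (g := e.symm)
          (e.continuousAt_symm (e.map_source hpe)) continuousAt_fst
      refine h1.preimage_mem_nhds ?_
      simp only [e.left_inv hpe]
      exact hN
    have h2 := G.map_nhds_eq hpG ▸ image_mem_map (m := G) hQ
    rw [hG, Real.exp_zero, one_smul, e.left_inv hpe] at h2
    have h3 : ContinuousAt (fun q : Heis.sphere (m + 1) r => (q : Heis (m + 1)).1) (F p) :=
      (continuous_fst.comp continuous_subtype_val).continuousAt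
    have h4 : (F p : Heis (m + 1)).1 = (f p).1 - z₀ := by rw [hF]
    filter_upwards [h3.preimage_mem_nhds (h4.symm ▸ h2)] with q hq
    obtain ⟨⟨y, s⟩, hy, hyq⟩ := hq
    rw [hG] at hyq
    -- Comparing norms, `eˢ r = r`, so a nearby point of the sphere is reached with `s = 0`, that is
    -- from `M` itself.
    have h5 := congrArg norm hyq
    rw [norm_smul, hnorm, q.2.1, Real.norm_of_nonneg (Real.exp_pos s).le,
      mul_eq_right₀ hr.ne', Real.exp_eq_one_iff] at h5
    rw [h5, Real.exp_zero, one_smul] at hyq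
    have h6 : F (e.symm y) = q := by
      apply Subtype.ext
      rw [hF]
      exact Prod.ext hyq q.2.2.symm
    rw [← h6]; exact hy
  rw [isLocalHomeomorph_iff_isOpenEmbedding_restrict]
  intro p
  obtain ⟨e, G, hpe, hpG, hG⟩ := hloc p
  have hc : ContinuousAt (fun q => (e q, (0 : ℝ))) p :=
    (e.continuousAt hpe).prodMk continuousAt_const
  obtain ⟨U, hU, hUo, hpU⟩ := mem_nhds_iff.1
    (inter_mem (hc.preimage_mem_nhds (G.open_source.mem_nhds hpG)) (e.open_source.mem_nhds hpe))
  refine ⟨U, hUo.mem_nhds hpU, IsOpenEmbedding.of_continuous_injective_isOpenMap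
    (hcont.comp continuous_subtype_val) ?_ (hopen.comp hUo.isOpenMap_subtype_val)⟩
  rintro ⟨q₁, hq₁⟩ ⟨q₂, hq₂⟩ h
  have h1 : F q₁ = F q₂ := h
  have h2 := congrArg (fun q : Heis.sphere (m + 1) r => (q : Heis (m + 1)).1) h1
  simp only [hF] at h2
  have h3 : G (e q₁, 0) = G (e q₂, 0) := by
    rw [hG, hG, e.left_inv (hU hq₁).2, e.left_inv (hU hq₂).2, h2]
  have h4 := G.injOn (hU hq₁).1 (hU hq₂).1 h3
  exact Subtype.ext (e.injOn (hU hq₁).2 (hU hq₂).2 (Prod.ext_iff.1 h4).1)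

/-- `curvature_trace` shows that every admissible choice of data gives this value; a local unitary
frame shows that such data exist. -/
theorem isWebsterCurvatureAt_iff {c : ℝ} (hc : ∀ p, ‖(ν p).1‖ = c)
    (hD : IsCRFundamentalField S ν) (p : M) (r : ℝ) :
    IsWebsterCurvatureAt S p r ↔ r = m * (m + 1) * c ^ 2 := by
  constructor
  · rintro ⟨e, he, hps, V, hV, hVe, hpV, ϑ, φ, A, R, hϑ, hφ, hR, hr⟩
    obtain ⟨ξ, H⟩ := exists_isContactHypersurface hf he hν hν0
    have h1 := (H.mono hV hVe).curvature_trace hϑ hφ hR (fun y hy => hD e he y (hVe hy)) hpV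
    rw [← hr, vecChart, hc] at h1
    exact_mod_cast h1
  · rintro rfl
    obtain ⟨e, he, hps⟩ : ∃ e ∈ IsManifold.maximalAtlas 𝓘(ℝ, PHModel m) ∞ M, p ∈ e.source :=
      ⟨_, IsManifold.chart_mem_maximalAtlas p, mem_chart_source _ p⟩
    obtain ⟨ξ, H⟩ := exists_isContactHypersurface hf he hν hν0
    obtain ⟨V, hVe, hV, hxV, g, hg⟩ := H.exists_local_frame (e.map_source hps)
    have H' := H.mono hV hVe
    have hD' : ∀ y ∈ V, ∀ v, formInChart e S.θ y v = 0 →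
      dbar (endoInChart e S.J) (vecChart e ν) y v = 0 := fun y hy => hD e he y (hVe hy)
    obtain ⟨X, hXs, hX⟩ := H'.exists_dual hg
    have hϑ := H'.isAdmissibleCoframe hg
    have hφ := H'.isConnection hg hXs hX
    have hR := H'.isCurvature hg (fun x hx k v => rfl) hφ hD'
    refine ⟨e, he, hps, V, hV, hVe, hxV, _, _, _, _, hϑ, hφ, hR, ?_⟩
    rw [H'.curvature_trace hϑ hφ hR hD' hxV, vecChart, hc]

end Rigidity

end

/-! ### The main theorem -/

theorem theoremD (m : ℕ) (hm : 1 ≤ m) {M : Type*} [TopologicalSpace M]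
    [ChartedSpace (PHModel m) M] [IsManifold 𝓘(ℝ, PHModel m) ∞ M] [SimplyConnectedSpace M]
    (S : PseudohermitianStructure m M) (f : M → Heis (m + 1))
    (hf : IsPseudohermitianSubmanifold S f)
    (ν : M → Heis (m + 1)) (hν : IsFundamentalVectorField S f ν) (hν0 : ∀ p, ν p ≠ 0) :
    (TorsionVanishes S ↔ SecondFundamentalFormVanishes S f) ∧
    (TorsionVanishes S → ∃ c : ℝ, 0 < c ∧
      (∀ p, Heis.length (f p) (ν p) = c) ∧
      (∀ (p : M) (r : ℝ), IsWebsterCurvatureAt S p r ↔ r = m * (m + 1) * c ^ 2) ∧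
      ∃ Φ : Heis (m + 1) → Heis (m + 1), Heis.IsRigidMotion Φ ∧
        ∃ F : M → Heis.sphere (m + 1) (1 / c), (∀ p, (F p : Heis (m + 1)) = Φ (f p)) ∧
          IsLocalHomeomorph F ∧
          (Function.Injective f → IsOpenEmbedding F)) := by
  refine ⟨(torsionVanishes_iff hf hν hν0).trans
    (secondFundamentalFormVanishes_iff hf hν hν0).symm, fun hT => ?_⟩
  have hD := (torsionVanishes_iff hf hν hν0).1 hT
  obtain ⟨c, hc, hνc, z₀, τ, hνz, hτ⟩ := exists_center hf hν hν0 hm hD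
  refine ⟨c, hc, fun p => (length_eq hν p).trans (hνc p),
    isWebsterCurvatureAt_iff hf hν hν0 hνc hD, fun q => Heis.mul (-z₀, -τ) q,
    ⟨(-z₀, -τ), LinearIsometryEquiv.refl ℂ _, fun q => rfl⟩, ?_⟩
  -- The last coordinate after translation is `t - τ + Im ⟪z₀, z⟫`, which vanishes by `hτ`.
  have hΦ : ∀ p, Heis.mul (-z₀, -τ) (f p) = ((f p).1 - z₀, 0) := by
    intro p
    have := hτ p
    simp only [Heis.mul, inner_neg_left, Complex.neg_im]
    refine Prod.ext (by simp only; abel) ?_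
    simp only; linarith
  have hnorm : ∀ p, ‖(f p).1 - z₀‖ = 1 / c := by
    intro p
    have h1 := congrArg norm (hνz p)
    rw [hνc, norm_smul, norm_mul, Complex.norm_I, one_mul, Complex.norm_real,
      Real.norm_of_nonneg (sq_nonneg c)] at h1
    field_simp
    have h2 : c * (c * ‖(f p).1 - z₀‖) = c * 1 := by linarith
    linarith [mul_left_cancel₀ hc.ne' h2]
  set F : M → Heis.sphere (m + 1) (1 / c) := fun p =>
    ⟨Heis.mul (-z₀, -τ) (f p), by rw [hΦ]; exact ⟨hnorm p, rfl⟩⟩ with hF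
  have hloc : IsLocalHomeomorph F := by
    -- From `w = i c² (z - z₀)` one gets `i w = -c² (z - z₀)`, whence `κ = -1 / c²`.
    refine isLocalHomeomorph_sphere hf hν hν0 (κ := -(c ^ 2)⁻¹) (z₀ := z₀)
      (neg_ne_zero.2 (inv_ne_zero (pow_pos hc 2).ne')) (fun p => ?_) (by positivity)
      (fun p => hΦ p)
    have hcc : (c : ℂ) ≠ 0 := by exact_mod_cast hc.ne'
    rw [hνz p, ← Complex.coe_smul, smul_smul, smul_smul]
    push_cast
    have h1 : -((c : ℂ) ^ 2)⁻¹ * Complex.I * Complex.I * (c : ℂ) ^ 2 = 1 := by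
      field_simp
      linear_combination -Complex.I_sq
    rw [← mul_assoc, h1, one_smul]
  refine ⟨F, fun p => rfl, hloc, fun hinj => hloc.isOpenEmbedding_of_injective ?_⟩
  intro p q hpq
  have h1 := congrArg (fun a : Heis.sphere (m + 1) (1 / c) => (a : Heis (m + 1))) hpq
  simp only [hF, hΦ] at h1
  have h2 : (f p).1 = (f q).1 := sub_left_injective (Prod.ext_iff.1 h1).1
  -- The `t`-coordinate is recovered from `z` through `t = τ - Im ⟪z₀, z⟫`.
  refine hinj (Prod.ext h2 ?_)
  have h3 := hτ p
  have h4 := hτ q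
  rw [h2] at h3
  linarith
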